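/- **Setting.** Let $n\ge 1$, let $X=(x_1,\dots,x_p)\in\mathbb R^{n\times p}$ have columns with $\|x_j\|_2^2=n$, and let $y=X\beta+\varepsilon$, $S=\mathrm{supp}(\beta)$, where $X_S^\top X_S$ is invertible. Let $P_S$ be the orthogonal projection onto the column space of $X_S$, $P_S^\perp=I-P_S$, and let $\hat\beta^o$ be the oracle LSE: $\hat\beta^o_S=(X_S^\top X_S)^{-1}X_S^\top y$, $\hat\beta^o_{S^c}=0$. For fixed $\lambda>0$ let $\rho(t)=\rho(t;\lambda)$ satisfy: $\rho(0)=0$, $\rho(-t)=\rho(t)$, $\rho$ is nondecreasing on $[0,\infty)$, $\rho(x+y)\le\rho(x)+\rho(y)$ for $x,y\ge0$, and $\rho$ is left- and right-differentiable at every $t>0$. Put $\|\rho(b)\|_1=\sum_j\rho(b_j)$, $\lambda^*=\inf_{t>0}\{t/2+\rho(t)/t\}$, and let $\dot\rho(t)$ denote any value between the left and right derivatives of $\rho$ at $t$ (the one-sided derivatives at $0$ may be infinite; $\dot\rho(0+)$ is the right derivative at $0$). The global solution is the unique minimizer over $b\in\mathbb R^p$ of $L(b)=\|y-Xb\|_2^2/(2n)+\|\rho(b)\|_1$.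 A vector $b$ is an approximate local solution with excess $\nu\ge0$ if $\|X^\top(Xb-y)/n+\dot\rho(b)\|_2^2\le\nu$ for some choice of the values $\dot\rho(b_j)$, and a local solution if $\nu=0$. For $\kappa\ge0$ let $\theta(t,\kappa)=\sup_s\{-\mathrm{sgn}(s-t)(\dot\rho(s)-\dot\rho(t))-\kappa|s-t|\}$, where the supremum is also over the admissible values of $\dot\rho(s)$. When $b$ is a local solution, $\theta(b,\kappa)=0$ means that $\theta(b_j,\kappa)=0$ for all $j$, with $\dot\rho(b_j)$ the value for which the local-solution equation holds. For $\eta\in(0,1)$, $\eta$ null-consistency means $\min_b\{\|\varepsilon/\eta-Xb\|_2^2/(2n)+\|\rho(b)\|_1\}=\|\varepsilon/\eta\|_2^2/(2n)$. Let $\kappa_-(m)$ and $\kappa_+(m)$ be the minimum and maximum of $\|Xu\|_2^2/n$ over $\|u\|_0\le m$, $\|u\|_2=1$ (minimum over the empty set $=\infty$). Let $\xi=(1+\eta)/(1-\eta)$, $$\mathrm{RIF}_1=\inf\Big\{\tfrac{|S|\,\|X^\top Xu\|_\infty}{n\|u\|_1}:\|\rho(u_{S^c})\|_1<\xi\|\rho(u_S)\|_1\Big\},\qquad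 \Delta(a,k)=\sup\{\|\rho(b)\|_1:\|b\|_1\le ak,\ \|b\|_0=k\},$$ and $\Delta=\Delta\big((1+\eta)\lambda^*/\mathrm{RIF}_1,|S|\big)$ (with $1/0=\infty$, $1/\infty=0$). Call $m$ *admissible* for $\eta$ if one of the following holds. (A) $\Delta<\infty$ and $m=m_0+\lfloor\xi\Delta/\rho(t_0)\rfloor$, where either $t_0>0$ is real, $m_0\ge1$ is an integer and $\sqrt{2\xi\kappa_+(m_0)\Delta/m_0}+\|X^\top\varepsilon/n\|_\infty<\inf_{0<s<t_0}\dot\rho(s)$, or $t_0=m_0=0$ and $\rho(t_0)$ is read as $\rho(0+)>0$. (B) $\lambda^*=\lambda$, $\rho$ is bounded and concave on $(0,\infty)$, $\gamma^*=\sup_t\rho(t)/\lambda^2$, and for some $a_0>0$, $a_1\ge0$, $\gamma>0$, $\alpha>0$: $1-a_1/\gamma>\eta$, $\dot\rho(a_0\lambda)\ge\lambda(1-a_1/\gamma)$, $\alpha|S|$ is an integer, $2\gamma^*\kappa_+(\alpha|S|)/\alpha<(1-a_1/\gamma-\eta)^2(1-\eta)/(1+\eta)$, and, with $g=(\gamma^*/a_0)/(1-a_1/\gamma)$,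 either $m=(\alpha+g)|S|$ and $(\xi-1)g\le\alpha$, or $m=(\alpha+\xi g)|S|$. **Theorem.** (i) Suppose $\|X_{S^c}^\top P_S^\perp\varepsilon/n\|_\infty\le\dot\rho(0+)$. Then $\hat\beta^o$ is an approximate local solution with excess $\nu=\|\dot\rho(\hat\beta^o_S)\|_2^2$. If in addition $\eta$ null-consistency holds and $\nu=0=\theta(\hat\beta^o,\kappa)$ for some $0\le\kappa<\kappa_-(m+|S|)$ with $m$ admissible for $\eta$, then $\hat\beta^o$ is the global solution. (ii) Fix a version of $\dot\rho$ (one admissible value at each $t$) and let $$\theta_1=\inf\big\{\theta\ge0:\ \|(X_S^\top X_S/n)^{-1}\dot\rho(v_S+\hat\beta^o_S)\|_\infty\le\theta\lambda^*\ \ \forall\,\|v_S\|_\infty\le\theta\lambda^*\big\},$$ $$\theta_2=\sup\big\{\|X_{S^c}^\top X_S(X_S^\top X_S)^{-1}\dot\rho(v_S+\hat\beta^o_S)\|_\infty/\lambda^*:\ \|v_S\|_\infty\le\theta_1\lambda^*\big\}.$$ Suppose $\theta_1<\infty$, $\dot\rho$ is uniformly continuous on $\bigcup_{j\in S}[\hat\beta^o_j-\theta_1\lambda^*,\hat\beta^o_j+\theta_1\lambda^*]$,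 $\mathrm{sgn}(\hat\beta^o)=\mathrm{sgn}(\beta)$, $\min_{j\in S}|\hat\beta^o_j|>\theta_1\lambda^*$, $\theta_2<1$ and $\lambda^*\ge\|X^\top P_S^\perp\varepsilon/n\|_\infty/(1-\theta_2)$. Then there is a local solution $\tilde\beta^o$ with $\mathrm{sgn}(\tilde\beta^o)=\mathrm{sgn}(\beta)$ and $\|\tilde\beta^o-\hat\beta^o\|_\infty\le\theta_1\lambda^*$. If in addition $\eta$ null-consistency holds, then any such $\tilde\beta^o$ with $\theta(\tilde\beta^o,\kappa)=0$ for some $0\le\kappa<\kappa_-(m+|S|)$, with $m$ admissible for $\eta$, is the global solution. -/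

import Mathlib

namespace PenLS

open Filter Topology Matrix

noncomputable section

/-- Standing conditions on the penalty `ρ = ρ(·; λ)`. -/
structure IsPenalty (ρ : ℝ → ℝ) : Prop where
  zero : ρ 0 = 0
  even : ∀ t, ρ (-t) = ρ t
  mono : MonotoneOn ρ (Set.Ici 0)
  subadd : ∀ x y, 0 ≤ x → 0 ≤ y → ρ (x + y) ≤ ρ x + ρ y

/-- Left- and right-differentiability at every `t > 0`. -/
def LRDifferentiable (ρ : ℝ → ℝ) : Prop :=
  ∀ t : ℝ, 0 < t →
    DifferentiableWithinAt ℝ ρ (Set.Iio t) t ∧ DifferentiableWithinAt ℝ ρ (Set.Ioi t) t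

/-- `a ∈ [-∞, ∞]` is the right derivative of `ρ` at `t`; at `t = 0` this is `ρ̇(0+)`, which is
infinite for instance for the bridge penalties. -/
def HasRightSlope (ρ : ℝ → ℝ) (t : ℝ) (a : EReal) : Prop :=
  Tendsto (fun h : ℝ => (((ρ (t + h) - ρ t) / h : ℝ) : EReal)) (𝓝[>] 0) (𝓝 a)

/-- `a ∈ [-∞, ∞]` is the left derivative of `ρ` at `t`. -/
def HasLeftSlope (ρ : ℝ → ℝ) (t : ℝ) (a : EReal) : Prop :=
  Tendsto (fun h : ℝ => (((ρ (t + h) - ρ t) / h : ℝ) : EReal)) (𝓝[<] 0) (𝓝 a)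

/-- The set of admissible values of `ρ̇(t)`: all reals between the left and the right derivative. -/
def pdot (ρ : ℝ → ℝ) (t : ℝ) : Set ℝ :=
  {d | ∃ a b : EReal, HasLeftSlope ρ t a ∧ HasRightSlope ρ t b ∧
    min a b ≤ (d : EReal) ∧ (d : EReal) ≤ max a b}

/-- The threshold level `λ* = inf_{t > 0} (t / 2 + ρ(t) / t)`. -/
def threshold (ρ : ℝ → ℝ) : ℝ :=
  sInf ((fun t : ℝ => t / 2 + ρ t / t) '' Set.Ioi 0)

/-- The support of a vector. -/
def supp {p : ℕ} (b : Fin p → ℝ) : Finset (Fin p) :=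
  Finset.univ.filter (fun j => b j ≠ 0)

/-- The penalized least squares loss. -/
def loss {n p : ℕ} (X : Matrix (Fin n) (Fin p) ℝ) (y : Fin n → ℝ) (ρ : ℝ → ℝ)
    (b : Fin p → ℝ) : ℝ :=
  (∑ i, (y i - (X *ᵥ b) i) ^ 2) / (2 * n) + ∑ j, ρ (b j)

/-- `b` is the (unique) global minimizer of the penalized loss. -/
def IsGlobalSolution {n p : ℕ} (X : Matrix (Fin n) (Fin p) ℝ) (y : Fin n → ℝ) (ρ : ℝ → ℝ)
    (b : Fin p → ℝ) : Prop :=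
  IsMinOn (loss X y ρ) Set.univ b ∧ ∀ b', IsMinOn (loss X y ρ) Set.univ b' → b' = b

/-- `b` is an approximate local solution with excess `ν`, where `d j` is the value chosen for
`ρ̇(b j)`. -/
def IsApproxLocalWith {n p : ℕ} (X : Matrix (Fin n) (Fin p) ℝ) (y : Fin n → ℝ) (ρ : ℝ → ℝ)
    (ν : ℝ) (b d : Fin p → ℝ) : Prop :=
  (∀ j, d j ∈ pdot ρ (b j)) ∧ ∑ j, ((Xᵀ *ᵥ (X *ᵥ b - y)) j / n + d j) ^ 2 ≤ ν

/-- `b` is an approximate local solution with excess `ν`. -/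
def IsApproxLocal {n p : ℕ} (X : Matrix (Fin n) (Fin p) ℝ) (y : Fin n → ℝ) (ρ : ℝ → ℝ)
    (ν : ℝ) (b : Fin p → ℝ) : Prop :=
  ∃ d, IsApproxLocalWith X y ρ ν b d

/-- The nonconvexity measure `θ(t, κ)`, where `d` is the value of `ρ̇(t)`; the supremum runs over
all `s` and all admissible values `e` of `ρ̇(s)`. -/
def nonconvexity (ρ : ℝ → ℝ) (κ t d : ℝ) : EReal :=
  ⨆ s : ℝ, ⨆ e ∈ pdot ρ s, ((-Real.sign (s - t) * (e - d) - κ * |s - t| : ℝ) : EReal)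

/-- The `η` null-consistency condition. -/
def NullConsistent {n p : ℕ} (X : Matrix (Fin n) (Fin p) ℝ) (ε : Fin n → ℝ) (ρ : ℝ → ℝ)
    (η : ℝ) : Prop :=
  IsLeast
    (Set.range fun b : Fin p → ℝ =>
      (∑ i, (ε i / η - (X *ᵥ b) i) ^ 2) / (2 * n) + ∑ j, ρ (b j))
    ((∑ i, (ε i / η) ^ 2) / (2 * n))

/-- The lower sparse eigenvalue `κ₋(m)` (`∞` when there is no unit vector with at most `m`
nonzero entries). -/
def kappaMinus {n p : ℕ} (X : Matrix (Fin n) (Fin p) ℝ) (m : ℝ) : ENNReal :=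
  ⨅ u ∈ {u : Fin p → ℝ | ((supp u).card : ℝ) ≤ m ∧ ∑ j, u j ^ 2 = 1},
    ENNReal.ofReal ((∑ i, (X *ᵥ u) i ^ 2) / n)

/-- The upper sparse eigenvalue `κ₊(m)`. -/
def kappaPlus {n p : ℕ} (X : Matrix (Fin n) (Fin p) ℝ) (m : ℝ) : ℝ :=
  sSup ((fun u : Fin p → ℝ => (∑ i, (X *ᵥ u) i ^ 2) / n) ''
    {u | ((supp u).card : ℝ) ≤ m ∧ ∑ j, u j ^ 2 = 1})

/-- The restricted invertibility factor `RIF₁(ξ, S)`, with values in `[0, ∞]`. -/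
def RIF1 {n p : ℕ} (X : Matrix (Fin n) (Fin p) ℝ) (ρ : ℝ → ℝ) (ξ : ℝ)
    (S : Finset (Fin p)) : ENNReal :=
  ⨅ u ∈ {u : Fin p → ℝ | ∑ j ∈ Sᶜ, ρ (u j) < ξ * ∑ j ∈ S, ρ (u j)},
    ENNReal.ofReal ((S.card : ℝ) * ‖Xᵀ *ᵥ (X *ᵥ u)‖ / (n * ∑ j, |u j|))

/-- `Δ(a, k) = sup {‖ρ(b)‖₁ : ‖b‖₁ ≤ a k, ‖b‖₀ = k}` over `b ∈ ℝᵖ`, with values in `[0, ∞]`. -/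
def Delta (p : ℕ) (ρ : ℝ → ℝ) (a : ENNReal) (k : ℕ) : ENNReal :=
  ⨆ b ∈ {b : Fin p → ℝ | ENNReal.ofReal (∑ j, |b j|) ≤ a * k ∧ (supp b).card = k},
    ENNReal.ofReal (∑ j, ρ (b j))

/-- `ρ(t₀)`, read as the right limit `ρ(0+)` when `t₀ = 0`. -/
def valueAt (ρ : ℝ → ℝ) (t0 : ℝ) : ℝ :=
  if t0 = 0 then sInf (ρ '' Set.Ioi 0) else ρ t0

/-- `ξ = (1 + η) / (1 - η)`. -/
def xi (η : ℝ) : ℝ := (1 + η) / (1 - η)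

/-- `Δ(a₁ λ*, |S|)` with `a₁ = (1 + η) / RIF₁(ξ, S)`. -/
def DeltaS {n p : ℕ} (X : Matrix (Fin n) (Fin p) ℝ) (ρ : ℝ → ℝ) (S : Finset (Fin p))
    (η : ℝ) : ENNReal :=
  Delta p ρ (ENNReal.ofReal (1 + η) / RIF1 X ρ (xi η) S * ENNReal.ofReal (threshold ρ)) S.card

/-- The sparsity bound `m = m₀ + ⌊ξ Δ(a₁ λ*, |S|) / ρ(t₀)⌋`, for `t₀, m₀` with `t₀ = m₀ = 0` or
`t₀, m₀ > 0` and
`(2 ξ κ₊(m₀) Δ(a₁ λ*, |S|) / m₀)^{1/2} + ‖Xᵀ ε / n‖_∞ < inf_{0 < s < t₀} ρ̇(s)`. -/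
def IsSparsityBound {n p : ℕ} (X : Matrix (Fin n) (Fin p) ℝ) (ε : Fin n → ℝ) (ρ : ℝ → ℝ)
    (S : Finset (Fin p)) (η m : ℝ) : Prop :=
  ∃ (t0 : ℝ) (m0 : ℕ), DeltaS X ρ S η ≠ ⊤ ∧ 0 < valueAt ρ t0 ∧
    ((t0 = 0 ∧ m0 = 0) ∨
      (0 < t0 ∧ 0 < m0 ∧
        ((Real.sqrt (2 * xi η * kappaPlus X m0 * (DeltaS X ρ S η).toReal / m0)
            + ‖fun j : Fin p => (Xᵀ *ᵥ ε) j / n‖ : ℝ) : EReal)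
          < ⨅ s ∈ Set.Ioo 0 t0, ⨅ d ∈ pdot ρ s, (d : EReal))) ∧
    m = m0 + (⌊xi η * (DeltaS X ρ S η).toReal / valueAt ρ t0⌋₊ : ℝ)

/-- The sparsity bound for bounded concave penalties with threshold level `λ* = λ`, where
`γ* = sup ρ / λ²` and `g = (γ* / a₀) / (1 - a₁ / γ)`: `m = (α + g) |S|` provided that
`(ξ - 1) g ≤ α`, and `m = (α + ξ g) |S|` in any case. -/
def IsSparsityBoundBounded {n p : ℕ} (X : Matrix (Fin n) (Fin p) ℝ) (ρ : ℝ → ℝ) (lam : ℝ)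
    (S : Finset (Fin p)) (η m : ℝ) : Prop :=
  ∃ (γs a0 a1 γ α g : ℝ) (m0 : ℕ),
    threshold ρ = lam ∧ ConcaveOn ℝ (Set.Ioi 0) ρ ∧
    BddAbove (Set.range ρ) ∧ γs = sSup (Set.range ρ) / lam ^ 2 ∧
    0 < a0 ∧ 0 ≤ a1 ∧ 0 < γ ∧ η < 1 - a1 / γ ∧
    (∃ d ∈ pdot ρ (a0 * lam), lam * (1 - a1 / γ) ≤ d) ∧
    0 < α ∧ (m0 : ℝ) = α * S.card ∧
    2 * γs * kappaPlus X m0 / α < (1 - a1 / γ - η) ^ 2 * (1 - η) / (1 + η) ∧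
    g = (γs / a0) / (1 - a1 / γ) ∧
    (((xi η - 1) * g ≤ α ∧ m = (α + g) * S.card) ∨ m = (α + xi η * g) * S.card)

/-- The columns `X_S`. -/
def cols {n p : ℕ} (X : Matrix (Fin n) (Fin p) ℝ) (S : Finset (Fin p)) :
    Matrix (Fin n) {j // j ∈ S} ℝ :=
  X.submatrix id Subtype.val

/-- The Gram matrix `X_Sᵀ X_S`. -/
def gram {n p : ℕ} (X : Matrix (Fin n) (Fin p) ℝ) (S : Finset (Fin p)) :
    Matrix {j // j ∈ S} {j // j ∈ S} ℝ :=
  (cols X S)ᵀ * cols X S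

/-- The oracle least squares estimator: `(X_Sᵀ X_S)⁻¹ X_Sᵀ y` on `S` and zero off `S`. -/
def oracle {n p : ℕ} (X : Matrix (Fin n) (Fin p) ℝ) (y : Fin n → ℝ) (S : Finset (Fin p)) :
    Fin p → ℝ :=
  fun j => if h : j ∈ S then ((gram X S)⁻¹ *ᵥ ((cols X S)ᵀ *ᵥ y)) ⟨j, h⟩ else 0

/-- The column space of `X_S`. -/
def colSpace {n p : ℕ} (X : Matrix (Fin n) (Fin p) ℝ) (S : Finset (Fin p)) :
    Submodule ℝ (EuclideanSpace ℝ (Fin n)) :=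
  Submodule.span ℝ ((fun j => WithLp.toLp 2 (fun i => X i j)) '' (S : Set (Fin p)))

/-- `P_S^⊥ ε`, with `P_S` the orthogonal projection onto the column space of `X_S`. -/
def projPerp {n p : ℕ} (X : Matrix (Fin n) (Fin p) ℝ) (S : Finset (Fin p)) (ε : Fin n → ℝ) :
    Fin n → ℝ :=
  fun i => ((colSpace X S)ᗮ.starProjection (WithLp.toLp 2 ε)) i

/-- The set of `θ ≥ 0` such that `‖(X_Sᵀ X_S / n)⁻¹ ρ̇(v_S + b_S)‖_∞ ≤ θ λ*` for all
`‖v_S‖_∞ ≤ θ λ*`; here `r` is the chosen version of `ρ̇`. -/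
def theta1Set {n p : ℕ} (X : Matrix (Fin n) (Fin p) ℝ) (S : Finset (Fin p)) (lamStar : ℝ)
    (r : ℝ → ℝ) (b : Fin p → ℝ) : Set ℝ :=
  {θ | 0 ≤ θ ∧ ∀ v : {j // j ∈ S} → ℝ, ‖v‖ ≤ θ * lamStar →
    ‖((n : ℝ)⁻¹ • gram X S)⁻¹ *ᵥ (fun j => r (v j + b j))‖ ≤ θ * lamStar}

/-- `θ₁`. -/
def theta1 {n p : ℕ} (X : Matrix (Fin n) (Fin p) ℝ) (S : Finset (Fin p)) (lamStar : ℝ)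
    (r : ℝ → ℝ) (b : Fin p → ℝ) : ℝ :=
  sInf (theta1Set X S lamStar r b)

/-- `θ₂ = sup {‖X_{Sᶜ}ᵀ X_S (X_Sᵀ X_S)⁻¹ ρ̇(v_S + b_S)‖_∞ / λ* : ‖v_S‖_∞ ≤ θ₁ λ*}`. -/
def theta2 {n p : ℕ} (X : Matrix (Fin n) (Fin p) ℝ) (S : Finset (Fin p)) (lamStar : ℝ)
    (r : ℝ → ℝ) (b : Fin p → ℝ) : ℝ :=
  sSup ((fun v : {j // j ∈ S} → ℝ =>
      ‖(cols X Sᶜ)ᵀ *ᵥ (cols X S *ᵥ ((gram X S)⁻¹ *ᵥ (fun j => r (v j + b j))))‖ / lamStar) ''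
    {v | ‖v‖ ≤ theta1 X S lamStar r b * lamStar})

end

end PenLS

/-! Both "global solution" claims come down to uniqueness (`isGlobalSolution_of_local`). A minimizer
exists (`exists_isMinOn_loss`), and at any minimizer `b'` minus the gradient is an admissible value
of `ρ̇`, as one-coordinate perturbations show. A local solution `b` with vanishing nonconvexity has
a controlled failure of monotonicity, so `‖X(b' - b)‖² / n = ∑ (gradient difference) (b' - b)_j ≤ κ
‖b' - b‖²`. If `b' - b` has at most `m + |S|` nonzero entries, `κ < κ₋(m + |S|)` forces `b' = b`.

It remains to show that a minimizer has at most `m` nonzero entries off `S`. With `u = b' - β`,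
null-consistency absorbs the noise and gives `‖Xu‖² / (2n) + ‖ρ(u_{Sᶜ})‖₁ ≤ ξ ‖ρ(u_S)‖₁`. The right
side is bounded through `RIF1` and `Delta`, or by the supremum of `ρ`. Large entries off `S` are
counted by their penalty. At small ones `ρ̇` exceeds the noise, so `Xᵀ X u / n` is large there, and
`κ₊` limits their number.

The oracle residual is `P_S^⊥ ε`, which yields the approximate local solution of (i). For (ii), the
stationarity equation on `S` is `G v + ρ̇(v + β̂ᵒ) = 0` with `G` the scaled Gram matrix. As `G` is
symmetric and `ρ̇` acts coordinatewise, this is the gradient of a potential, and minimizing it over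
the box of radius `θ₁ λ*` solves the equation without a topological fixed point theorem
(`exists_mulVec_add_eq_zero`). Off `S`, the gradient is at most `θ₂ λ* + (1 - θ₂) λ* = λ* ≤ ρ̇(0+)`.
-/

namespace PenLS

open Filter Topology Matrix

noncomputable section

variable {n p : ℕ} {ρ : ℝ → ℝ}

/-! ### Consequences of subadditivity, and the threshold level. -/

namespace IsPenalty

theorem map_abs (hρ : IsPenalty ρ) (t : ℝ) : ρ |t| = ρ t := by
  rcases abs_choice t with h | h <;> rw [h]
  exact hρ.even t

theorem le_of_abs_le (hρ : IsPenalty ρ) {s t : ℝ} (h : |s| ≤ |t|) : ρ s ≤ ρ t := by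
  rw [← hρ.map_abs s, ← hρ.map_abs t]
  exact hρ.mono (abs_nonneg s) (abs_nonneg t) h

theorem nonneg (hρ : IsPenalty ρ) (t : ℝ) : 0 ≤ ρ t := by
  rw [← hρ.zero]
  exact hρ.le_of_abs_le (by simp)

theorem add_le (hρ : IsPenalty ρ) (s t : ℝ) : ρ (s + t) ≤ ρ s + ρ t := by
  rw [← hρ.map_abs s, ← hρ.map_abs t]
  refine (hρ.le_of_abs_le ?_).trans (hρ.subadd _ _ (abs_nonneg s) (abs_nonneg t))
  rw [abs_of_nonneg (a := |s| + |t|) (by positivity)]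
  exact abs_add_le s t

theorem sub_le (hρ : IsPenalty ρ) (s t : ℝ) : ρ s - ρ t ≤ ρ (s - t) := by
  have := hρ.add_le (s - t) t
  rw [sub_add_cancel] at this
  linarith

theorem nat_mul_le (hρ : IsPenalty ρ) (k : ℕ) (t : ℝ) : ρ (k * t) ≤ k * ρ t := by
  induction k with
  | zero => simp [hρ.zero]
  | succ k ih =>
    have := hρ.add_le (k * t) t
    push_cast
    rw [add_mul, add_mul, one_mul, one_mul]
    linarith

/-- Subadditivity bounds the chord slope below on `(0, s]`. -/
theorem div_le_div_of_le (hρ : IsPenalty ρ) {s t : ℝ} (ht : 0 < t) (hts : t ≤ s) :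
    ρ s / (2 * s) ≤ ρ t / t := by
  have hs : 0 < s := ht.trans_le hts
  -- Cover `s` by `⌈s / t⌉` steps of length `t`. Since `s / t ≥ 1`, rounding up at most doubles it,
  -- hence the factor 2.
  have h1 : s ≤ ⌈s / t⌉₊ * t := (div_le_iff₀ ht).1 (Nat.le_ceil _)
  have h2 : (⌈s / t⌉₊ : ℝ) ≤ 2 * (s / t) := by
    have := (Nat.ceil_lt_add_one (by positivity : 0 ≤ s / t)).le
    have h3 : 1 ≤ s / t := (one_le_div ht).2 hts
    linarith
  have h3 : ρ s ≤ ρ (⌈s / t⌉₊ * t) := hρ.mono hs.le (hs.le.trans h1) h1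
  have h4 := hρ.nat_mul_le ⌈s / t⌉₊ t
  have h5 := mul_le_mul_of_nonneg_right h2 (hρ.nonneg t)
  rw [div_le_div_iff₀ (by positivity) ht]
  calc ρ s * t ≤ 2 * (s / t) * ρ t * t := by gcongr; linarith
    _ = ρ t * (2 * s) := by field_simp

/-- Dichotomy: a penalty is identically zero or positive off the origin. The chord bound handles
points below `|s|`, monotonicity those above. -/
theorem pos_of_ne_zero (hρ : IsPenalty ρ) {s : ℝ} (hs : 0 < ρ s) {t : ℝ} (ht : t ≠ 0) :
    0 < ρ t := by
  rw [← hρ.map_abs t]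
  have ht' := abs_pos.2 ht
  rw [← hρ.map_abs s] at hs
  have hs' : 0 < |s| := by
    rcases (abs_nonneg s).eq_or_lt with h | h
    · rw [← h, hρ.zero] at hs
      exact absurd hs (lt_irrefl _)
    · exact h
  rcases le_total |t| |s| with h | h
  · have := hρ.div_le_div_of_le ht' h
    have h2 : 0 < ρ |s| / (2 * |s|) := by positivity
    exact (div_pos_iff_of_pos_right ht').1 (h2.trans_le this)
  · exact hs.trans_le (hρ.mono hs'.le ht'.le h)

theorem bddBelow_threshold (hρ : IsPenalty ρ) :
    BddBelow ((fun t : ℝ => t / 2 + ρ t / t) '' Set.Ioi 0) := by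
  refine ⟨0, ?_⟩
  rintro _ ⟨t, ht, rfl⟩
  have ht : (0 : ℝ) < t := ht
  have := hρ.nonneg t
  positivity

theorem threshold_le (hρ : IsPenalty ρ) {t : ℝ} (ht : 0 < t) :
    threshold ρ ≤ t / 2 + ρ t / t :=
  csInf_le hρ.bddBelow_threshold ⟨t, ht, rfl⟩

theorem le_threshold {c : ℝ} (h : ∀ t, 0 < t → c ≤ t / 2 + ρ t / t) : c ≤ threshold ρ := by
  refine le_csInf ⟨_, 1, Set.mem_Ioi.2 one_pos, rfl⟩ ?_
  rintro _ ⟨t, ht, rfl⟩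
  exact h t ht

theorem threshold_nonneg (hρ : IsPenalty ρ) : 0 ≤ threshold ρ := by
  refine le_threshold fun t ht => ?_
  have := hρ.nonneg t
  positivity

/-- For `t ≤ 1` the chord bound keeps `ρ t / t` above `ρ 1 / 2`; for `t ≥ 1` the term `t / 2`
suffices. -/
theorem threshold_pos (hρ : IsPenalty ρ) {s : ℝ} (hs : 0 < ρ s) : 0 < threshold ρ := by
  have h1 : 0 < ρ 1 := hρ.pos_of_ne_zero hs one_ne_zero
  refine lt_of_lt_of_le (b := min (1 / 2) (ρ 1 / 2)) (by positivity) (le_threshold fun t ht => ?_)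
  rcases le_total t 1 with h | h
  · have := hρ.div_le_div_of_le ht h
    rw [mul_one] at this
    exact (min_le_right _ _).trans (by linarith)
  · have : 0 ≤ ρ t / t := div_nonneg (hρ.nonneg t) ht.le
    exact (min_le_left _ _).trans (by linarith)

theorem exists_pos_of_threshold_pos (h : 0 < threshold ρ) (hρ : IsPenalty ρ) :
    ∃ s, 0 < ρ s := by
  by_contra! h0
  have h0 : ∀ s, ρ s = 0 := fun s => le_antisymm (h0 s) (hρ.nonneg s)
  -- The infimum is tested at `t = λ*` itself: a zero penalty would give `λ* ≤ λ* / 2`.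
  have := hρ.threshold_le h
  rw [h0, zero_div] at this
  linarith

theorem continuousAt (hρ : IsPenalty ρ) (hd : LRDifferentiable ρ) {t : ℝ} (ht : t ≠ 0) :
    ContinuousAt ρ t := by
  have key : ∀ s : ℝ, 0 < s → ContinuousAt ρ s := fun s hs =>
    continuousAt_iff_continuous_left'_right'.2
      ⟨(hd s hs).1.continuousWithinAt, (hd s hs).2.continuousWithinAt⟩
  have h1 : ContinuousAt (fun s => ρ |s|) t :=
    ContinuousAt.comp (f := fun s : ℝ => |s|) (key |t| (abs_pos.2 ht)) continuous_abs.continuousAt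
  simpa only [hρ.map_abs] using h1

/-- A jump at the origin is allowed, but there `ρ` takes its least value, so lower semicontinuity
survives. -/
theorem lowerSemicontinuous (hρ : IsPenalty ρ) (hd : LRDifferentiable ρ) :
    LowerSemicontinuous ρ := by
  intro t
  by_cases ht : t = 0
  · intro c hc
    rw [ht, hρ.zero] at hc
    exact Eventually.of_forall fun s => hc.trans_le (hρ.nonneg s)
  · exact (hρ.continuousAt hd ht).lowerSemicontinuousAt

end IsPenalty

/-! ### One-sided slopes and admissible derivative values -/

theorem HasRightSlope.neg_left (hρ : IsPenalty ρ) {t : ℝ} {a : EReal}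
    (h : HasRightSlope ρ t a) : HasLeftSlope ρ (-t) (-a) := by
  unfold HasLeftSlope
  have h1 : Tendsto (fun h : ℝ => -h) (𝓝[<] 0) (𝓝[>] 0) := by
    simpa using tendsto_neg_nhdsLT (a := (0 : ℝ))
  have h2 := (continuous_neg.tendsto a).comp (h.comp h1)
  refine h2.congr fun s => ?_
  have e1 : ρ (t + -s) = ρ (-t + s) := by rw [← hρ.even]; congr 1; ring
  simp only [Function.comp]
  rw [e1, ← hρ.even t, ← EReal.coe_neg, div_neg, neg_neg]

theorem HasLeftSlope.neg_right (hρ : IsPenalty ρ) {t : ℝ} {a : EReal}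
    (h : HasLeftSlope ρ t a) : HasRightSlope ρ (-t) (-a) := by
  unfold HasRightSlope
  have h1 : Tendsto (fun h : ℝ => -h) (𝓝[>] 0) (𝓝[<] 0) := by
    simpa using tendsto_neg_nhdsGT (a := (0 : ℝ))
  have h2 := (continuous_neg.tendsto a).comp (h.comp h1)
  refine h2.congr fun s => ?_
  have e1 : ρ (t + -s) = ρ (-t + s) := by rw [← hρ.even]; congr 1; ring
  simp only [Function.comp]
  rw [e1, ← hρ.even t, ← EReal.coe_neg, div_neg, neg_neg]

theorem neg_mem_pdot (hρ : IsPenalty ρ) {t d : ℝ} (h : d ∈ pdot ρ t) : -d ∈ pdot ρ (-t) := by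
  obtain ⟨a, b, ha, hb, h1, h2⟩ := h
  refine ⟨-b, -a, hb.neg_left hρ, ha.neg_right hρ, ?_, ?_⟩
  · simp only [EReal.coe_neg, min_le_iff, EReal.neg_le_neg_iff]
    exact (le_max_iff.1 h2).symm
  · simp only [EReal.coe_neg, le_max_iff, EReal.neg_le_neg_iff]
    exact (min_le_iff.1 h1).symm

theorem HasRightSlope.le {t c : ℝ} {a : EReal} (h : HasRightSlope ρ t a) (f : ℝ → ℝ)
    (hf : Tendsto f (𝓝[>] 0) (𝓝 c))
    (hc : ∀ᶠ s in 𝓝[>] (0 : ℝ), f s ≤ (ρ (t + s) - ρ t) / s) : (c : EReal) ≤ a :=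
  le_of_tendsto_of_tendsto ((continuous_coe_real_ereal.tendsto c).comp hf) h
    (hc.mono fun _ hs => EReal.coe_le_coe_iff.2 hs)

theorem HasRightSlope.ge {t c : ℝ} {a : EReal} (h : HasRightSlope ρ t a) (f : ℝ → ℝ)
    (hf : Tendsto f (𝓝[>] 0) (𝓝 c))
    (hc : ∀ᶠ s in 𝓝[>] (0 : ℝ), (ρ (t + s) - ρ t) / s ≤ f s) : a ≤ (c : EReal) :=
  le_of_tendsto_of_tendsto h ((continuous_coe_real_ereal.tendsto c).comp hf)
    (hc.mono fun _ hs => EReal.coe_le_coe_iff.2 hs)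

theorem HasLeftSlope.le {t c : ℝ} {a : EReal} (h : HasLeftSlope ρ t a) (f : ℝ → ℝ)
    (hf : Tendsto f (𝓝[<] 0) (𝓝 c))
    (hc : ∀ᶠ s in 𝓝[<] (0 : ℝ), f s ≤ (ρ (t + s) - ρ t) / s) : (c : EReal) ≤ a :=
  le_of_tendsto_of_tendsto ((continuous_coe_real_ereal.tendsto c).comp hf) h
    (hc.mono fun _ hs => EReal.coe_le_coe_iff.2 hs)

theorem HasLeftSlope.ge {t c : ℝ} {a : EReal} (h : HasLeftSlope ρ t a) (f : ℝ → ℝ)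
    (hf : Tendsto f (𝓝[<] 0) (𝓝 c))
    (hc : ∀ᶠ s in 𝓝[<] (0 : ℝ), (ρ (t + s) - ρ t) / s ≤ f s) : a ≤ (c : EReal) :=
  le_of_tendsto_of_tendsto h ((continuous_coe_real_ereal.tendsto c).comp hf)
    (hc.mono fun _ hs => EReal.coe_le_coe_iff.2 hs)

/-- A lower quadratic support line of `ρ` at `t` is an admissible derivative value. -/
theorem mem_pdot_of_forall_le {t c : ℝ} {a b : EReal} (ha : HasLeftSlope ρ t a)
    (hb : HasRightSlope ρ t b) (h : ∀ s, c * s ≤ ρ (t + s) - ρ t + s ^ 2 / 2) :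
    c ∈ pdot ρ t := by
  have hlim : Tendsto (fun s : ℝ => c - s / 2) (𝓝 0) (𝓝 c) := by
    have : Continuous fun s : ℝ => c - s / 2 := by fun_prop
    simpa using this.tendsto 0
  have h1 : a ≤ (c : EReal) := by
    refine ha.ge _ (hlim.mono_left nhdsWithin_le_nhds) ?_
    filter_upwards [self_mem_nhdsWithin] with s (hs : s < 0)
    rw [div_le_iff_of_neg hs]
    nlinarith [h s]
  have h2 : (c : EReal) ≤ b := by
    refine hb.le _ (hlim.mono_left nhdsWithin_le_nhds) ?_
    filter_upwards [self_mem_nhdsWithin] with s (hs : 0 < s)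
    rw [le_div_iff₀ hs]
    nlinarith [h s]
  exact ⟨a, b, ha, hb, (min_le_left _ _).trans h1, h2.trans (le_max_right _ _)⟩

/-- By evenness the left derivative at `0` is `-D`, so the admissible values there fill `[-D, D]`.
-/
theorem mem_pdot_zero (hρ : IsPenalty ρ) {D : EReal} (hD : HasRightSlope ρ 0 D) {d : ℝ}
    (hd : ((|d| : ℝ) : EReal) ≤ D) : d ∈ pdot ρ 0 := by
  refine ⟨-D, D, by simpa using hD.neg_left hρ, hD, (min_le_left _ _).trans ?_,
    le_trans ?_ (le_max_right _ _)⟩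
  · rw [EReal.neg_le, ← EReal.coe_neg]
    exact le_trans (EReal.coe_le_coe_iff.2 (neg_le_abs d)) hd
  · exact le_trans (EReal.coe_le_coe_iff.2 (le_abs_self d)) hd

/-- Let `s → 0+` in `ρ s / s ≥ λ* - s / 2`. Hence a gradient of size at most `λ*` is admissible at a
zero coordinate. -/
theorem threshold_le_rightSlope (hρ : IsPenalty ρ) {D : EReal} (hD : HasRightSlope ρ 0 D) :
    (threshold ρ : EReal) ≤ D := by
  have hlim : Tendsto (fun s : ℝ => threshold ρ - s / 2) (𝓝 0) (𝓝 (threshold ρ)) := by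
    have : Continuous fun s : ℝ => threshold ρ - s / 2 := by fun_prop
    simpa using this.tendsto 0
  refine hD.le _ (hlim.mono_left nhdsWithin_le_nhds) ?_
  filter_upwards [self_mem_nhdsWithin] with s (hs : 0 < s)
  rw [zero_add, hρ.zero, sub_zero]
  linarith [hρ.threshold_le hs]

theorem exists_slopes_of_pos (hd : LRDifferentiable ρ) {t : ℝ} (ht : 0 < t) :
    ∃ a b : EReal, HasLeftSlope ρ t a ∧ HasRightSlope ρ t b := by
  have h1 := (hd t ht).1.hasDerivWithinAt
  have h2 := (hd t ht).2.hasDerivWithinAt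
  rw [hasDerivWithinAt_iff_tendsto_slope' (by simp)] at h1 h2
  refine ⟨_, _, (continuous_coe_real_ereal.tendsto _).comp
    ((h1.comp (f := fun h : ℝ => t + h) (x := 𝓝[<] 0) ?_).congr ?_),
    (continuous_coe_real_ereal.tendsto _).comp
    ((h2.comp (f := fun h : ℝ => t + h) (x := 𝓝[>] 0) ?_).congr ?_)⟩
  · refine tendsto_nhdsWithin_iff.2 ⟨?_, ?_⟩
    · have : Continuous fun h : ℝ => t + h := by fun_prop
      simpa using (this.tendsto 0).mono_left (nhdsWithin_le_nhds (s := Set.Iio 0))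
    · filter_upwards [self_mem_nhdsWithin] with s (hs : s < 0)
      simpa using hs
  · intro s
    simp [slope, div_eq_inv_mul]
  · refine tendsto_nhdsWithin_iff.2 ⟨?_, ?_⟩
    · have : Continuous fun h : ℝ => t + h := by fun_prop
      simpa using (this.tendsto 0).mono_left (nhdsWithin_le_nhds (s := Set.Ioi 0))
    · filter_upwards [self_mem_nhdsWithin] with s (hs : 0 < s)
      simpa using hs
  · intro s
    simp [slope, div_eq_inv_mul]

theorem exists_slopes (hρ : IsPenalty ρ) (hd : LRDifferentiable ρ) {D : EReal}
    (hD : HasRightSlope ρ 0 D) (t : ℝ) :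
    ∃ a b : EReal, HasLeftSlope ρ t a ∧ HasRightSlope ρ t b := by
  rcases lt_trichotomy t 0 with h | rfl | h
  · obtain ⟨a, b, ha, hb⟩ := exists_slopes_of_pos hd (neg_pos.2 h)
    exact ⟨-b, -a, by simpa using hb.neg_left hρ, by simpa using ha.neg_right hρ⟩
  · exact ⟨-D, D, by simpa using hD.neg_left hρ, hD⟩
  · exact exists_slopes_of_pos hd h

/-- For a concave penalty the admissible values on the left dominate the chord slope. -/
theorem chord_le_of_mem_pdot (hc : ConcaveOn ℝ (Set.Ioi 0) ρ) {s t d : ℝ} (hs : 0 < s)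
    (hst : s < t) (hd : d ∈ pdot ρ s) : (ρ t - ρ s) / (t - s) ≤ d := by
  obtain ⟨a, b, ha, hb, h1, -⟩ := hd
  have h2 : (((ρ t - ρ s) / (t - s) : ℝ) : EReal) ≤ a := by
    refine ha.le _ tendsto_const_nhds ?_
    filter_upwards [self_mem_nhdsWithin,
      mem_nhdsWithin_of_mem_nhds (Ioi_mem_nhds (neg_lt_zero.2 hs))] with h hh hh'
    have hh : h < 0 := hh
    have hh' : -s < h := hh'
    have := hc.slope_anti_adjacent (x := s + h) (y := s) (z := t)
      (Set.mem_Ioi.2 (by linarith)) (Set.mem_Ioi.2 (by linarith)) (by linarith) hst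
    have e : (ρ s - ρ (s + h)) / (s - (s + h)) = (ρ (s + h) - ρ s) / h := by
      rw [← neg_div_neg_eq]; congr 1 <;> ring
    rwa [e] at this
  have h3 : (((ρ t - ρ s) / (t - s) : ℝ) : EReal) ≤ b := by
    refine hb.le _ tendsto_const_nhds ?_
    filter_upwards [self_mem_nhdsWithin,
      mem_nhdsWithin_of_mem_nhds (Iio_mem_nhds (sub_pos.2 hst))] with h hh hh'
    have hh : 0 < h := hh
    have hh' : h < t - s := hh'
    have := hc.slope_anti_adjacent (x := s) (y := s + h) (z := t)
      (Set.mem_Ioi.2 (by linarith)) (Set.mem_Ioi.2 (by linarith)) (by linarith) (by linarith)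
    rw [div_le_div_iff₀ (by linarith) (by linarith)] at this
    rw [div_le_div_iff₀ (by linarith) (by linarith)]
    nlinarith
  exact EReal.coe_le_coe_iff.1 ((le_min h2 h3).trans h1)

/-- For a concave penalty the admissible values on the right are below the chord slope. -/
theorem le_chord_of_mem_pdot (hc : ConcaveOn ℝ (Set.Ioi 0) ρ) {s t d : ℝ} (hs : 0 < s)
    (hst : s < t) (hd : d ∈ pdot ρ t) : d ≤ (ρ t - ρ s) / (t - s) := by
  obtain ⟨a, b, ha, hb, -, h1⟩ := hd
  have h2 : a ≤ (((ρ t - ρ s) / (t - s) : ℝ) : EReal) := by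
    refine ha.ge _ tendsto_const_nhds ?_
    filter_upwards [self_mem_nhdsWithin,
      mem_nhdsWithin_of_mem_nhds (Ioi_mem_nhds (sub_neg.2 hst))] with h hh hh'
    have hh : h < 0 := hh
    have hh' : s - t < h := hh'
    have := hc.slope_anti_adjacent (x := s) (y := t + h) (z := t)
      (Set.mem_Ioi.2 (by linarith)) (Set.mem_Ioi.2 (by linarith)) (by linarith) (by linarith)
    rw [div_le_div_iff₀ (by linarith) (by linarith)] at this
    rw [← neg_div_neg_eq, div_le_div_iff₀ (by linarith) (by linarith)]
    nlinarith
  have h3 : b ≤ (((ρ t - ρ s) / (t - s) : ℝ) : EReal) := by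
    refine hb.ge _ tendsto_const_nhds ?_
    filter_upwards [self_mem_nhdsWithin] with h hh
    have hh : 0 < h := hh
    have := hc.slope_anti_adjacent (x := s) (y := t) (z := t + h)
      (Set.mem_Ioi.2 (by linarith)) (Set.mem_Ioi.2 (by linarith)) (by linarith) (by linarith)
    rwa [add_sub_cancel_left] at this
  exact EReal.coe_le_coe_iff.1 (h1.trans (max_le h2 h3))

/-- Let `s → 0+` in `d (t - s) ≤ ρ t - ρ s ≤ ρ t`. The chord cannot start at `0` itself, since
concavity is assumed only on the open half-line. -/
theorem mul_le_of_mem_pdot (hρ : IsPenalty ρ) (hc : ConcaveOn ℝ (Set.Ioi 0) ρ) {t d : ℝ}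
    (ht : 0 < t) (hd : d ∈ pdot ρ t) : d * t ≤ ρ t := by
  have hlim : Tendsto (fun s : ℝ => d * (t - s)) (𝓝[>] 0) (𝓝 (d * t)) := by
    have : Continuous fun s : ℝ => d * (t - s) := by fun_prop
    simpa using (this.tendsto 0).mono_left nhdsWithin_le_nhds
  refine le_of_tendsto hlim ?_
  filter_upwards [self_mem_nhdsWithin,
    mem_nhdsWithin_of_mem_nhds (Iio_mem_nhds ht)] with s hs hs'
  have := le_chord_of_mem_pdot hc hs hs' hd
  rw [le_div_iff₀ (sub_pos.2 hs')] at this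
  linarith [hρ.nonneg s]

/-! ### The quadratic loss and existence of a minimizer. -/

theorem sum_transpose_mulVec_mul {ι κ : Type*} [Fintype ι] [Fintype κ] (X : Matrix ι κ ℝ)
    (w : ι → ℝ) (v : κ → ℝ) :
    ∑ j, (Xᵀ *ᵥ w) j * v j = ∑ i, w i * (X *ᵥ v) i := by
  change (Xᵀ *ᵥ w) ⬝ᵥ v = w ⬝ᵥ (X *ᵥ v)
  rw [Matrix.mulVec_transpose, Matrix.dotProduct_mulVec]

theorem sum_sq_sub_mulVec_add (X : Matrix (Fin n) (Fin p) ℝ) (y : Fin n → ℝ)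
    (b v : Fin p → ℝ) :
    ∑ i, (y i - (X *ᵥ (b + v)) i) ^ 2 = ∑ i, (y i - (X *ᵥ b) i) ^ 2
      + 2 * ∑ j, (Xᵀ *ᵥ (X *ᵥ b - y)) j * v j + ∑ i, (X *ᵥ v) i ^ 2 := by
  rw [sum_transpose_mulVec_mul, Finset.mul_sum, ← Finset.sum_add_distrib,
    ← Finset.sum_add_distrib]
  refine Finset.sum_congr rfl fun i _ => ?_
  rw [Matrix.mulVec_add, Pi.add_apply, Pi.sub_apply]
  ring

theorem loss_nonneg (hρ : IsPenalty ρ) (X : Matrix (Fin n) (Fin p) ℝ) (y : Fin n → ℝ)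
    (b : Fin p → ℝ) : 0 ≤ loss X y ρ b :=
  add_nonneg (div_nonneg (Finset.sum_nonneg fun _ _ => sq_nonneg _) (by positivity))
    (Finset.sum_nonneg fun _ _ => hρ.nonneg _)

theorem exists_tendsto_of_ultrafilter_abs_le {α : Type*} (U : Ultrafilter α) {f : α → ℝ} {M : ℝ}
    (h : ∀ᶠ k in U, |f k| ≤ M) : ∃ c, Tendsto f U (𝓝 c) := by
  obtain ⟨c, -, hc⟩ := (isCompact_Icc (a := -M) (b := M)).ultrafilter_le_nhds (U.map f)
    (by
      rw [Ultrafilter.coe_map, le_principal_iff]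
      exact h.mono fun k hk => abs_le.1 hk)
  exact ⟨c, hc⟩

/-- The penalized loss attains its minimum: coordinates that diverge along a minimizing sequence
are replaced by finite ones with the same fitted values. -/
theorem exists_isMinOn_loss (hn : 0 < n) (hρ : IsPenalty ρ) (hd : LRDifferentiable ρ)
    (X : Matrix (Fin n) (Fin p) ℝ) (y : Fin n → ℝ) :
    ∃ b, IsMinOn (loss X y ρ) Set.univ b := by
  classical
  have hn' : (0 : ℝ) < n := Nat.cast_pos.2 hn
  have hbdd : BddBelow (Set.range (loss X y ρ)) :=
    ⟨0, by rintro _ ⟨b, rfl⟩; exact loss_nonneg hρ X y b⟩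
  obtain ⟨u, -, hu, hmem⟩ := exists_seq_tendsto_sInf (Set.range_nonempty (loss X y ρ)) hbdd
  choose b hb using hmem
  set l := sInf (Set.range (loss X y ρ))
  -- Along an ultrafilter every bounded real sequence converges, which replaces repeated extraction
  -- of subsequences.
  let U : Ultrafilter ℕ := hyperfilter ℕ
  have hloss : Tendsto (fun k => loss X y ρ (b k)) U (𝓝 l) := by
    simp only [hb]
    exact hu.mono_left Nat.hyperfilter_le_atTop
  have hz : ∀ i, ∃ z, Tendsto (fun k => (X *ᵥ b k) i) U (𝓝 z) := by
    intro i
    -- The squared residual is at most `2n(l + 1)`, and `|a| ≤ a² + 1`.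
    refine exists_tendsto_of_ultrafilter_abs_le U (M := |y i| + (2 * n * (l + 1) + 1)) ?_
    filter_upwards [hloss.eventually_lt_const (lt_add_one l)] with k hk
    have h0 : 0 ≤ ∑ j, ρ (b k j) := Finset.sum_nonneg fun _ _ => hρ.nonneg _
    have h1 : (∑ i, (y i - (X *ᵥ b k) i) ^ 2) / (2 * n) ≤ l + 1 := by
      have : (∑ i, (y i - (X *ᵥ b k) i) ^ 2) / (2 * n) + ∑ j, ρ (b k j) < l + 1 := hk
      linarith
    rw [div_le_iff₀ (by positivity)] at h1
    have h2 := Finset.single_le_sum (f := fun i => (y i - (X *ᵥ b k) i) ^ 2)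
      (fun _ _ => sq_nonneg _) (Finset.mem_univ i)
    have h3 : (y i - (X *ᵥ b k) i) ^ 2 ≤ 2 * n * (l + 1) := by
      have := h2.trans h1; linarith
    have h4 : |y i - (X *ᵥ b k) i| ≤ 2 * n * (l + 1) + 1 := by
      rw [← sq_abs] at h3
      nlinarith [abs_nonneg (y i - (X *ᵥ b k) i)]
    have h5 := abs_sub_abs_le_abs_sub ((X *ᵥ b k) i) (y i)
    rw [abs_sub_comm] at h5
    linarith
  choose z hz using hz
  -- The coordinates without a limit; along `U` their absolute values eventually exceed every bound.
  let A : Finset (Fin p) :=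
    Finset.univ.filter fun j => ¬ ∃ c, Tendsto (fun k => b k j) U (𝓝 c)
  have hA : ∀ j ∈ A, ∀ M, ∀ᶠ k in U, M ≤ |b k j| := by
    intro j hj M
    have h1 : ¬ ∀ᶠ k in (U : Filter ℕ), |b k j| ≤ M := fun h =>
      (Finset.mem_filter.1 hj).2 (exists_tendsto_of_ultrafilter_abs_le U h)
    exact (Ultrafilter.eventually_not.2 h1).mono fun k hk => (not_le.1 hk).le
  have hAc : ∀ j, ∃ c, Tendsto (fun k => if j ∈ A then 0 else b k j) U (𝓝 c) ∧
      (j ∈ A → c = 0) := by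
    intro j
    by_cases hj : j ∈ A
    · exact ⟨0, by simp [hj], fun _ => rfl⟩
    · have : ∃ c, Tendsto (fun k => b k j) U (𝓝 c) := by simpa [A] using hj
      obtain ⟨c, hc⟩ := this
      exact ⟨c, by simpa [hj] using hc, fun h => absurd h hj⟩
  choose c hc hcA using hAc
  let W : Submodule ℝ (Fin p → ℝ) :=
    { carrier := {v | ∀ j, j ∉ A → v j = 0}
      add_mem' := fun {v w} hv hw j hj => by rw [Pi.add_apply, hv j hj, hw j hj, add_zero]
      zero_mem' := fun _ _ => rfl
      smul_mem' := fun a v hv j hj => by rw [Pi.smul_apply, hv j hj, smul_zero] }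
  -- The diverging coordinates contribute convergent fitted values. These lie in the image of `W`, a
  -- finite-dimensional and hence closed subspace, so a finite vector `a` attains the limit.
  have hmemW : ∃ a ∈ W, X *ᵥ a = z - X *ᵥ c := by
    have hclosed : IsClosed ((W.map X.mulVecLin : Submodule ℝ (Fin n → ℝ)) : Set (Fin n → ℝ)) :=
      Submodule.closed_of_finiteDimensional _
    have hlim : Tendsto (fun k => X *ᵥ (fun j => if j ∈ A then b k j else 0)) U
        (𝓝 (z - X *ᵥ c)) := by
      have h1 : Tendsto (fun k => X *ᵥ b k) U (𝓝 z) := tendsto_pi_nhds.2 hz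
      have h2 : Tendsto (fun k => X *ᵥ (fun j => if j ∈ A then 0 else b k j)) U
          (𝓝 (X *ᵥ c)) := by
        have hcont : Continuous fun v : Fin p → ℝ => X *ᵥ v := by fun_prop
        exact (hcont.tendsto c).comp (tendsto_pi_nhds.2 hc)
      refine (h1.sub h2).congr fun k => ?_
      rw [← Matrix.mulVec_sub]
      congr 1
      ext j
      by_cases hj : j ∈ A <;> simp [hj]
    have := hclosed.mem_of_tendsto hlim (Eventually.of_forall fun k =>
      ⟨fun j => if j ∈ A then b k j else 0, fun j hj => by simp [hj], rfl⟩)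
    obtain ⟨a, ha, hxa⟩ := this
    exact ⟨a, ha, hxa⟩
  obtain ⟨a, haW, ha⟩ := hmemW
  -- On `A`, `|b k j|` eventually exceeds `|a j|` and monotonicity applies; off `A`, lower
  -- semicontinuity does.
  have hlow : ∀ δ : ℝ, 0 < δ → ∀ j, ∀ᶠ k in U, ρ ((a + c) j) - δ ≤ ρ (b k j) := by
    intro δ hδ j
    by_cases hj : j ∈ A
    · filter_upwards [hA j hj |a j|] with k hk
      have := hρ.le_of_abs_le hk
      rw [Pi.add_apply, hcA j hj, add_zero]
      linarith
    · have h1 := hc j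
      simp only [hj, if_false] at h1
      rw [Pi.add_apply, haW j hj, zero_add]
      exact (h1.eventually (hρ.lowerSemicontinuous hd (c j) (ρ (c j) - δ) (by linarith))).mono
        fun k hk => le_of_lt hk
  have hXac : X *ᵥ (a + c) = z := by rw [Matrix.mulVec_add, ha, sub_add_cancel]
  have hle : loss X y ρ (a + c) ≤ l := by
    have hquad : Tendsto (fun k => (∑ i, (y i - (X *ᵥ b k) i) ^ 2) / (2 * n)) U
        (𝓝 ((∑ i, (y i - z i) ^ 2) / (2 * n))) :=
      (tendsto_finsetSum _ fun i _ => ((hz i).const_sub (y i)).pow 2).div_const _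
    refine le_of_forall_pos_le_add fun δ hδ => ?_
    have hpos : (0 : ℝ) < δ / (p + 1) := by positivity
    have h1 := ge_of_tendsto (hloss.sub hquad)
      (b := ∑ j, (ρ ((a + c) j) - δ / (p + 1))) (by
        filter_upwards [eventually_all.2 (hlow _ hpos)] with k hk
        rw [loss, add_sub_cancel_left]
        exact Finset.sum_le_sum fun j _ => hk j)
    rw [Finset.sum_sub_distrib, Finset.sum_const, Finset.card_univ, Fintype.card_fin,
      nsmul_eq_mul] at h1
    have h2 : (p : ℝ) * (δ / (p + 1)) ≤ δ := by
      rw [mul_div_assoc', div_le_iff₀ (by positivity)]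
      nlinarith
    rw [loss, hXac]
    linarith
  exact ⟨a + c, fun b' _ => hle.trans (csInf_le hbdd ⟨b', rfl⟩)⟩

/-! ### Necessary conditions at a global minimizer -/

theorem sum_sq_mulVec_single (X : Matrix (Fin n) (Fin p) ℝ) (hX : ∀ j, ∑ i, X i j ^ 2 = n)
    (j : Fin p) (s : ℝ) : ∑ i, (X *ᵥ Pi.single j s) i ^ 2 = n * s ^ 2 := by
  rw [← hX j, Finset.sum_mul]
  refine Finset.sum_congr rfl fun i _ => ?_
  rw [Matrix.mulVec_single]
  simp [mul_pow, mul_comm]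

/-- Compare `b` with `b + s e_j`. The column normalization makes the second-order term exactly `s² /
2`. -/
theorem coordinate_le_of_isMinOn (hn : 0 < n) {X : Matrix (Fin n) (Fin p) ℝ}
    (hX : ∀ j, ∑ i, X i j ^ 2 = n) {y : Fin n → ℝ} {b : Fin p → ℝ}
    (hb : IsMinOn (loss X y ρ) Set.univ b) (j : Fin p) (s : ℝ) :
    -((Xᵀ *ᵥ (X *ᵥ b - y)) j / n) * s ≤ ρ (b j + s) - ρ (b j) + s ^ 2 / 2 := by
  have hn' : (0 : ℝ) < n := Nat.cast_pos.2 hn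
  have h1 : loss X y ρ b ≤ loss X y ρ (b + Pi.single j s) := hb (Set.mem_univ _)
  have h2 : ∑ k, ρ ((b + Pi.single j s : Fin p → ℝ) k) - ∑ k, ρ (b k)
      = ρ (b j + s) - ρ (b j) := by
    rw [← Finset.sum_sub_distrib, Finset.sum_eq_single j]
    · simp
    · intro k _ hk
      simp [Pi.single_eq_of_ne hk]
    · simp
  have h3 : ∑ k, (Xᵀ *ᵥ (X *ᵥ b - y)) k * (Pi.single j s : Fin p → ℝ) k
      = (Xᵀ *ᵥ (X *ᵥ b - y)) j * s := by
    rw [Finset.sum_eq_single j]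
    · simp
    · intro k _ hk
      simp [Pi.single_eq_of_ne hk]
    · simp
  rw [loss, loss, sum_sq_sub_mulVec_add, h3, sum_sq_mulVec_single X hX] at h1
  have h4 : (∑ i, (y i - (X *ᵥ b) i) ^ 2 + 2 * ((Xᵀ *ᵥ (X *ᵥ b - y)) j * s) + n * s ^ 2)
      / (2 * n) = (∑ i, (y i - (X *ᵥ b) i) ^ 2) / (2 * n)
        + (Xᵀ *ᵥ (X *ᵥ b - y)) j / n * s + s ^ 2 / 2 := by
    field_simp
  rw [h4] at h1
  linarith

/-- Moving coordinate `j` by `±t` and using subadditivity gives `|g_j| t ≤ ρ t + t² / 2`. Dividing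
by `t` and taking the infimum produces exactly `λ*`. -/
theorem abs_gradient_le_threshold (hn : 0 < n) (hρ : IsPenalty ρ)
    {X : Matrix (Fin n) (Fin p) ℝ} (hX : ∀ j, ∑ i, X i j ^ 2 = n) {y : Fin n → ℝ}
    {b : Fin p → ℝ} (hb : IsMinOn (loss X y ρ) Set.univ b) (j : Fin p) :
    |(Xᵀ *ᵥ (X *ᵥ b - y)) j / n| ≤ threshold ρ := by
  refine IsPenalty.le_threshold fun t ht => ?_
  have h1 := coordinate_le_of_isMinOn hn hX hb j t
  have h2 := coordinate_le_of_isMinOn hn hX hb j (-t)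
  have h3 := hρ.add_le (b j) t
  have h4 := hρ.add_le (b j) (-t)
  rw [hρ.even t] at h4
  have h5 : |(Xᵀ *ᵥ (X *ᵥ b - y)) j / n| * t ≤ ρ t + t ^ 2 / 2 := by
    rcases abs_choice ((Xᵀ *ᵥ (X *ᵥ b - y)) j / n) with h | h <;> rw [h] <;> nlinarith
  have h6 : t / 2 + ρ t / t = (ρ t + t ^ 2 / 2) / t := by field_simp; ring
  rwa [h6, le_div_iff₀ ht]

theorem neg_gradient_mem_pdot (hn : 0 < n) (hρ : IsPenalty ρ) (hd : LRDifferentiable ρ)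
    {D : EReal} (hD : HasRightSlope ρ 0 D)
    {X : Matrix (Fin n) (Fin p) ℝ} (hX : ∀ j, ∑ i, X i j ^ 2 = n) {y : Fin n → ℝ}
    {b : Fin p → ℝ} (hb : IsMinOn (loss X y ρ) Set.univ b) (j : Fin p) :
    -((Xᵀ *ᵥ (X *ᵥ b - y)) j / n) ∈ pdot ρ (b j) := by
  obtain ⟨a, c, ha, hc⟩ := exists_slopes hρ hd hD (b j)
  exact mem_pdot_of_forall_le ha hc (coordinate_le_of_isMinOn hn hX hb j)

/-! ### Consequences of null-consistency -/

theorem NullConsistent.isMinOn (hρ : IsPenalty ρ) {X : Matrix (Fin n) (Fin p) ℝ}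
    {ε : Fin n → ℝ} {η : ℝ} (h : NullConsistent X ε ρ η) :
    IsMinOn (loss X (fun i => ε i / η) ρ) Set.univ 0 := by
  intro b _
  have := h.2 ⟨b, rfl⟩
  simpa [loss, hρ.zero] using this

/-- Expand the square: `‖ε / η‖²` cancels, leaving a bound on the noise term with a factor `η < 1`
in the applications, so it can be absorbed. -/
theorem NullConsistent.noise_le (hn : 0 < n) {X : Matrix (Fin n) (Fin p) ℝ}
    {ε : Fin n → ℝ} {η : ℝ} (hη : 0 < η) (h : NullConsistent X ε ρ η) (b : Fin p → ℝ) :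
    (∑ i, ε i * (X *ᵥ b) i) / n
      ≤ η * ((∑ i, (X *ᵥ b) i ^ 2) / (2 * n) + ∑ j, ρ (b j)) := by
  have hn' : (0 : ℝ) < n := Nat.cast_pos.2 hn
  have h1 : (∑ i, (ε i / η) ^ 2) / (2 * n) ≤
      (∑ i, (ε i / η - (X *ᵥ b) i) ^ 2) / (2 * n) + ∑ j, ρ (b j) := h.2 ⟨b, rfl⟩
  have h2 : ∑ i, (ε i / η - (X *ᵥ b) i) ^ 2 = ∑ i, (ε i / η) ^ 2
      - 2 * ((∑ i, ε i * (X *ᵥ b) i) / η) + ∑ i, (X *ᵥ b) i ^ 2 := by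
    rw [Finset.sum_div, Finset.mul_sum, ← Finset.sum_sub_distrib, ← Finset.sum_add_distrib]
    refine Finset.sum_congr rfl fun i _ => ?_
    field_simp
    ring
  rw [h2] at h1
  have h3 : (∑ i, (ε i / η) ^ 2 - 2 * ((∑ i, ε i * (X *ᵥ b) i) / η) + ∑ i, (X *ᵥ b) i ^ 2)
      / (2 * n) = (∑ i, (ε i / η) ^ 2) / (2 * n) - (∑ i, ε i * (X *ᵥ b) i) / n / η
        + (∑ i, (X *ᵥ b) i ^ 2) / (2 * n) := by
    field_simp
  rw [h3] at h1
  rw [← div_le_iff₀' hη]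
  linarith

/-- The gradient bound at the minimizer `0` for the response `ε / η`, where the gradient is `-Xᵀ ε /
(n η)`. -/
theorem NullConsistent.abs_noise_le (hn : 0 < n) (hρ : IsPenalty ρ)
    {X : Matrix (Fin n) (Fin p) ℝ} (hX : ∀ j, ∑ i, X i j ^ 2 = n)
    {ε : Fin n → ℝ} {η : ℝ} (hη : 0 < η) (h : NullConsistent X ε ρ η) (j : Fin p) :
    |(Xᵀ *ᵥ ε) j / n| ≤ η * threshold ρ := by
  have h1 := abs_gradient_le_threshold hn hρ hX (h.isMinOn hρ) j
  have h2 : (Xᵀ *ᵥ (X *ᵥ 0 - fun i => ε i / η)) j / n = -((Xᵀ *ᵥ ε) j / n) / η := by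
    have : (X *ᵥ 0 - fun i => ε i / η) = (-η⁻¹) • ε := by
      ext i
      simp [div_eq_inv_mul]
    rw [this, Matrix.mulVec_smul, Pi.smul_apply, smul_eq_mul]
    ring
  rw [h2, abs_div, abs_neg, abs_of_pos hη, div_le_iff₀ hη] at h1
  linarith

theorem one_lt_xi {η : ℝ} (h0 : 0 < η) (h1 : η < 1) : 1 < xi η := by
  rw [xi, one_lt_div (by linarith)]
  linarith

/-- The basic inequality for an estimator that beats the true coefficient vector. -/
theorem basic_inequality (hn : 0 < n) (hρ : IsPenalty ρ) {X : Matrix (Fin n) (Fin p) ℝ}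
    {β b : Fin p → ℝ} {ε y : Fin n → ℝ} (hy : y = X *ᵥ β + ε) {S : Finset (Fin p)}
    (hS : S = supp β) (hb : loss X y ρ b ≤ loss X y ρ β) :
    (∑ i, (X *ᵥ (b - β)) i ^ 2) / (2 * n) + ∑ j ∈ Sᶜ, ρ ((b - β) j)
      ≤ (∑ i, ε i * (X *ᵥ (b - β)) i) / n + ∑ j ∈ S, ρ ((b - β) j) := by
  have hn' : (0 : ℝ) < n := Nat.cast_pos.2 hn
  obtain ⟨u, rfl⟩ : ∃ u, b = β + u := ⟨b - β, by abel⟩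
  rw [add_sub_cancel_left]
  have h1 : X *ᵥ β - y = -ε := by rw [hy]; abel
  rw [loss, loss, sum_sq_sub_mulVec_add, sum_transpose_mulVec_mul, h1] at hb
  have h2 : ∑ i, (-ε) i * (X *ᵥ u) i = -∑ i, ε i * (X *ᵥ u) i := by
    simp [Finset.sum_neg_distrib]
  rw [h2, add_div, add_div] at hb
  have h3 : 2 * -(∑ i, ε i * (X *ᵥ u) i) / (2 * n) = -((∑ i, ε i * (X *ᵥ u) i) / n) := by
    field_simp
  rw [h3] at hb
  rw [← Finset.sum_add_sum_compl S fun j => ρ ((β + u) j),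
    ← Finset.sum_add_sum_compl S fun j => ρ (β j)] at hb
  have h4 : ∀ j ∈ Sᶜ, β j = 0 := fun j hj => by
    rw [hS] at hj
    simpa [supp] using hj
  have h5 : ∑ j ∈ Sᶜ, ρ ((β + u) j) = ∑ j ∈ Sᶜ, ρ (u j) :=
    Finset.sum_congr rfl fun j hj => by rw [Pi.add_apply, h4 j hj, zero_add]
  have h6 : ∑ j ∈ Sᶜ, ρ (β j) = 0 :=
    Finset.sum_eq_zero fun j hj => by rw [h4 j hj, hρ.zero]
  have h7 : ∑ j ∈ S, ρ (β j) - ∑ j ∈ S, ρ ((β + u) j) ≤ ∑ j ∈ S, ρ (u j) := by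
    rw [← Finset.sum_sub_distrib]
    refine Finset.sum_le_sum fun j _ => ?_
    have := hρ.sub_le (β j) ((β + u) j)
    rwa [Pi.add_apply, sub_add_cancel_left, hρ.even] at this
  linarith

/-- Inserting the noise bound into the basic inequality leaves `1 - η` on the left and `1 + η` on
the right; their ratio is `ξ`. -/
theorem cone_inequality (hn : 0 < n) (hρ : IsPenalty ρ) {X : Matrix (Fin n) (Fin p) ℝ}
    {β b : Fin p → ℝ} {ε y : Fin n → ℝ} (hy : y = X *ᵥ β + ε) {S : Finset (Fin p)}
    (hS : S = supp β) (hb : loss X y ρ b ≤ loss X y ρ β) {η : ℝ} (h0 : 0 < η) (h1 : η < 1)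
    (hnull : NullConsistent X ε ρ η) :
    (∑ i, (X *ᵥ (b - β)) i ^ 2) / (2 * n) + ∑ j ∈ Sᶜ, ρ ((b - β) j)
      ≤ xi η * ∑ j ∈ S, ρ ((b - β) j) := by
  have h2 := basic_inequality hn hρ hy hS hb
  have h3 := hnull.noise_le hn h0 (b - β)
  rw [← Finset.sum_add_sum_compl S] at h3
  rw [xi, div_mul_eq_mul_div, le_div_iff₀ (by linarith)]
  linarith

/-- `RIF1` uses the strict cone. If `Xu ≠ 0` the quadratic term gives strictness; if `Xu = 0` the
noise term vanishes and the constant improves from `ξ` to `1`. -/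
theorem cone_inequality_strict (hn : 0 < n) (hρ : IsPenalty ρ) {t : ℝ} (ht : 0 < ρ t)
    {X : Matrix (Fin n) (Fin p) ℝ}
    {β b : Fin p → ℝ} {ε y : Fin n → ℝ} (hy : y = X *ᵥ β + ε) {S : Finset (Fin p)}
    (hS : S = supp β) (hb : loss X y ρ b ≤ loss X y ρ β) {η : ℝ} (h0 : 0 < η) (h1 : η < 1)
    (hnull : NullConsistent X ε ρ η) (hne : b - β ≠ 0) :
    ∑ j ∈ Sᶜ, ρ ((b - β) j) < xi η * ∑ j ∈ S, ρ ((b - β) j) := by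
  have hn' : (0 : ℝ) < n := Nat.cast_pos.2 hn
  have h2 := cone_inequality hn hρ hy hS hb h0 h1 hnull
  have h3 := basic_inequality hn hρ hy hS hb
  have hsq : 0 ≤ ∑ i, (X *ᵥ (b - β)) i ^ 2 := Finset.sum_nonneg fun _ _ => sq_nonneg _
  rcases hsq.eq_or_lt with hq | hq
  · have hX0 : ∀ i, (X *ᵥ (b - β)) i = 0 := fun i => by
      have := (Finset.sum_eq_zero_iff_of_nonneg fun _ _ => sq_nonneg _).1 hq.symm i
        (Finset.mem_univ i)
      exact pow_eq_zero_iff (two_ne_zero) |>.1 this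
    simp only [hX0] at h3
    simp only [ne_eq, OfNat.ofNat_ne_zero, not_false_eq_true, zero_pow, Finset.sum_const_zero,
      zero_div, zero_add, mul_zero] at h3
    have hSn : 0 ≤ ∑ j ∈ S, ρ ((b - β) j) := Finset.sum_nonneg fun _ _ => hρ.nonneg _
    have hScn : 0 ≤ ∑ j ∈ Sᶜ, ρ ((b - β) j) := Finset.sum_nonneg fun _ _ => hρ.nonneg _
    rcases hSn.eq_or_lt with hs | hs
    · exfalso
      refine hne (funext fun j => ?_)
      by_contra hj
      have hpos := hρ.pos_of_ne_zero ht hj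
      have hle := Finset.single_le_sum (f := fun j => ρ ((b - β) j))
        (fun _ _ => hρ.nonneg _) (Finset.mem_univ j)
      rw [← Finset.sum_add_sum_compl S] at hle
      have h3 : ∑ j ∈ Sᶜ, ρ ((b - β) j) ≤ ∑ j ∈ S, ρ ((b - β) j) := h3
      linarith
    · have := one_lt_xi h0 h1
      nlinarith
  · have : 0 < (∑ i, (X *ᵥ (b - β)) i ^ 2) / (2 * n) := by positivity
    linarith

/-! ### Bounds through `Delta` and the restricted invertibility factor. -/

/-- `Delta` asks for exactly `|S|` nonzero entries, but `u` may vanish on part of `S`. Shrinking `u`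
by `1 - δ` frees `ℓ₁` mass `δ T`; each zero in `S` receives `δ T / p`. Then `δ → 0`, by continuity
of `ρ` off the origin. -/
theorem sum_rho_le_Delta (hρ : IsPenalty ρ) (hd : LRDifferentiable ρ) (S : Finset (Fin p))
    (u : Fin p → ℝ) {a : ENNReal} (h : ENNReal.ofReal (∑ j, |u j|) ≤ a * S.card)
    (hΔ : Delta p ρ a S.card ≠ ⊤) : ∑ j ∈ S, ρ (u j) ≤ (Delta p ρ a S.card).toReal := by
  classical
  set T := ∑ j, |u j|
  have hT : 0 ≤ T := Finset.sum_nonneg fun _ _ => abs_nonneg _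
  rcases hT.eq_or_lt with hT0 | hT0
  · have hu : ∀ j, u j = 0 := fun j => by
      have := (Finset.sum_eq_zero_iff_of_nonneg fun _ _ => abs_nonneg _).1 hT0.symm j
        (Finset.mem_univ j)
      exact abs_eq_zero.1 this
    rw [Finset.sum_eq_zero fun j _ => by rw [hu j, hρ.zero]]
    exact ENNReal.toReal_nonneg
  have hp : (0 : ℝ) < p := by
    rcases Nat.eq_zero_or_pos p with rfl | h
    · simp [T] at hT0
    · exact Nat.cast_pos.2 h
  have key : ∀ δ : ℝ, 0 < δ → δ < 1 →
      ∑ j ∈ S, ρ ((1 - δ) * u j) ≤ (Delta p ρ a S.card).toReal := by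
    intro δ h0 h1
    let b : Fin p → ℝ := fun j =>
      if j ∈ S then (if u j = 0 then δ * (T / p) else (1 - δ) * u j) else 0
    have hb0 : ∀ j, b j ≠ 0 ↔ j ∈ S := by
      intro j
      by_cases hj : j ∈ S <;> by_cases hu : u j = 0 <;>
        simp [b, hj, hu, h0.ne', hT0.ne', hp.ne', (sub_pos.2 h1).ne']
    have hsupp : supp b = S := by
      ext j
      simp [supp, hb0]
    have hsum : ∑ j, |b j| ≤ T := by
      calc ∑ j, |b j| ≤ ∑ j, ((1 - δ) * |u j| + δ * (T / p)) := by
            refine Finset.sum_le_sum fun j _ => ?_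
            have e1 : 0 ≤ (1 - δ) * |u j| := mul_nonneg (sub_nonneg.2 h1.le) (abs_nonneg _)
            have e2 : 0 < δ * (T / p) := by positivity
            by_cases hj : j ∈ S <;> by_cases hu : u j = 0
            · simp only [b, hj, hu, if_true]
              rw [abs_of_pos e2]
              simp
            · simp only [b, hj, hu, if_true, if_false]
              rw [abs_mul, abs_of_pos (sub_pos.2 h1)]
              linarith
            · simp only [b, hj, if_false, abs_zero]
              linarith
            · simp only [b, hj, if_false, abs_zero]
              linarith
        _ = T := by
            rw [Finset.sum_add_distrib, ← Finset.mul_sum, Finset.sum_const, Finset.card_univ,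
              Fintype.card_fin, nsmul_eq_mul]
            field_simp
            simp only [T]
            ring
    have hmem : b ∈ {b : Fin p → ℝ |
        ENNReal.ofReal (∑ j, |b j|) ≤ a * S.card ∧ (supp b).card = S.card} :=
      ⟨(ENNReal.ofReal_le_ofReal hsum).trans h, by rw [hsupp]⟩
    have hle : ENNReal.ofReal (∑ j, ρ (b j)) ≤ Delta p ρ a S.card :=
      le_iSup₂ (f := fun (b : Fin p → ℝ) (_ : b ∈ {b : Fin p → ℝ |
        ENNReal.ofReal (∑ j, |b j|) ≤ a * S.card ∧ (supp b).card = S.card}) =>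
          ENNReal.ofReal (∑ j, ρ (b j))) b hmem
    rw [ENNReal.ofReal_le_iff_le_toReal hΔ] at hle
    refine le_trans ?_ hle
    refine le_trans (Finset.sum_le_sum fun j hj => ?_)
      (Finset.sum_le_sum_of_subset_of_nonneg (Finset.subset_univ S) fun _ _ _ => hρ.nonneg _)
    by_cases hu : u j = 0
    · rw [hu, mul_zero, hρ.zero]
      exact hρ.nonneg _
    · simp [b, hj, hu]
  have hlim : Tendsto (fun δ : ℝ => ∑ j ∈ S, ρ ((1 - δ) * u j)) (𝓝[>] 0)
      (𝓝 (∑ j ∈ S, ρ (u j))) := by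
    refine tendsto_finsetSum _ fun j _ => ?_
    by_cases hu : u j = 0
    · simp [hu]
    · have h1 : Tendsto (fun δ : ℝ => (1 - δ) * u j) (𝓝[>] 0) (𝓝 (u j)) := by
        have : Continuous fun δ : ℝ => (1 - δ) * u j := by fun_prop
        simpa using (this.tendsto 0).mono_left (nhdsWithin_le_nhds (s := Set.Ioi 0))
      exact (hρ.continuousAt hd hu).tendsto.comp h1
  refine le_of_tendsto hlim ?_
  filter_upwards [self_mem_nhdsWithin,
    mem_nhdsWithin_of_mem_nhds (Iio_mem_nhds one_pos)] with δ h0 h1 using key δ h0 h1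

/-- The vector `u` competes in the infimum defining `RIF1`, so `RIF1 · ‖u‖₁ ≤ |S| c l`. When `RIF1 =
0` the right side is `⊤`, because `c`, `l` and `|S|` are positive. -/
theorem l1_le_of_cone (hn : 0 < n) {X : Matrix (Fin n) (Fin p) ℝ} {S : Finset (Fin p)}
    {u : Fin p → ℝ} {ξ c l : ℝ} (hu : u ≠ 0) (hS : S.Nonempty) (hc : 0 < c) (hl : 0 < l)
    (hcone : ∑ j ∈ Sᶜ, ρ (u j) < ξ * ∑ j ∈ S, ρ (u j))
    (hgrad : ∀ j, |(Xᵀ *ᵥ (X *ᵥ u)) j / n| ≤ c * l) :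
    ENNReal.ofReal (∑ j, |u j|)
      ≤ (ENNReal.ofReal c / RIF1 X ρ ξ S * ENNReal.ofReal l) * S.card := by
  have hn' : (0 : ℝ) < n := Nat.cast_pos.2 hn
  have hT : 0 < ∑ j, |u j| := by
    obtain ⟨j, hj⟩ := Function.ne_iff.1 hu
    exact Finset.sum_pos' (fun _ _ => abs_nonneg _) ⟨j, Finset.mem_univ j, abs_pos.2 hj⟩
  have hk : (0 : ℝ) < S.card := Nat.cast_pos.2 hS.card_pos
  have hR : RIF1 X ρ ξ S ≤ ENNReal.ofReal (S.card * (c * l) / ∑ j, |u j|) := by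
    refine (iInf₂_le (f := fun (u : Fin p → ℝ)
      (_ : u ∈ {u : Fin p → ℝ | ∑ j ∈ Sᶜ, ρ (u j) < ξ * ∑ j ∈ S, ρ (u j)}) =>
      ENNReal.ofReal ((S.card : ℝ) * ‖Xᵀ *ᵥ (X *ᵥ u)‖ / (n * ∑ j, |u j|))) u hcone).trans
      (ENNReal.ofReal_le_ofReal ?_)
    have h1 : ‖Xᵀ *ᵥ (X *ᵥ u)‖ ≤ n * (c * l) := by
      refine (pi_norm_le_iff_of_nonneg (by positivity)).2 fun j => ?_
      have := hgrad j
      rwa [abs_div, abs_of_pos hn', div_le_iff₀' hn'] at this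
    rw [div_le_div_iff₀ (by positivity) hT]
    calc (S.card : ℝ) * ‖Xᵀ *ᵥ (X *ᵥ u)‖ * ∑ j, |u j|
        ≤ S.card * (n * (c * l)) * ∑ j, |u j| := by gcongr
      _ = _ := by ring
  have hk' : (S.card : ENNReal) ≠ 0 := by exact_mod_cast hS.card_pos.ne'
  rcases eq_or_ne (RIF1 X ρ ξ S) 0 with h0 | h0
  · rw [h0, ENNReal.div_zero (ENNReal.ofReal_pos.2 hc).ne', ENNReal.top_mul
      (ENNReal.ofReal_pos.2 hl).ne', ENNReal.top_mul hk']
    exact le_top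
  · have htop : RIF1 X ρ ξ S ≠ ⊤ := ne_top_of_le_ne_top ENNReal.ofReal_ne_top hR
    have e : (ENNReal.ofReal c / RIF1 X ρ ξ S * ENNReal.ofReal l) * S.card
        = ENNReal.ofReal (S.card * (c * l)) / RIF1 X ρ ξ S := by
      rw [ENNReal.ofReal_mul hk.le, ENNReal.ofReal_mul hc.le, ENNReal.ofReal_natCast,
        div_eq_mul_inv, div_eq_mul_inv]
      ring
    rw [e, ENNReal.le_div_iff_mul_le (Or.inl h0) (Or.inl htop)]
    refine (mul_le_mul_right hR _).trans ?_
    rw [← ENNReal.ofReal_mul hT.le]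
    refine ENNReal.ofReal_le_ofReal (le_of_eq ?_)
    field_simp

/-! ### Sparse eigenvalues -/

/-- Cauchy–Schwarz in each row. Boundedness is needed for the real `sSup` to be a genuine supremum.
-/
theorem bddAbove_kappaPlus (X : Matrix (Fin n) (Fin p) ℝ) (m : ℝ) :
    BddAbove ((fun u : Fin p → ℝ => (∑ i, (X *ᵥ u) i ^ 2) / n) ''
      {u | ((supp u).card : ℝ) ≤ m ∧ ∑ j, u j ^ 2 = 1}) := by
  refine ⟨(∑ i, ∑ j, X i j ^ 2) / n, ?_⟩
  rintro _ ⟨u, ⟨-, hu⟩, rfl⟩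
  refine div_le_div_of_nonneg_right (Finset.sum_le_sum fun i _ => ?_) (Nat.cast_nonneg n)
  have := Finset.sum_mul_sq_le_sq_mul_sq Finset.univ (X i) u
  rwa [hu, mul_one] at this

theorem kappaPlus_nonneg (X : Matrix (Fin n) (Fin p) ℝ) (m : ℝ) : 0 ≤ kappaPlus X m := by
  refine Real.sSup_nonneg ?_
  rintro _ ⟨u, -, rfl⟩
  exact div_nonneg (Finset.sum_nonneg fun _ _ => sq_nonneg _) (Nat.cast_nonneg n)

/-- Normalization of a nonzero vector. -/
theorem exists_normalized (X : Matrix (Fin n) (Fin p) ℝ) {w : Fin p → ℝ}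
    (hw : 0 < ∑ j, w j ^ 2) : ∃ u : Fin p → ℝ, supp u = supp w ∧ ∑ j, u j ^ 2 = 1 ∧
      ∑ i, (X *ᵥ w) i ^ 2 = (∑ i, (X *ᵥ u) i ^ 2) * ∑ j, w j ^ 2 := by
  have hs : 0 < √(∑ j, w j ^ 2) := Real.sqrt_pos.2 hw
  have hsq : √(∑ j, w j ^ 2) ^ 2 = ∑ j, w j ^ 2 := Real.sq_sqrt hw.le
  refine ⟨(√(∑ j, w j ^ 2))⁻¹ • w, ?_, ?_, ?_⟩
  · ext j
    simp [supp, hs.ne']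
  · simp only [Pi.smul_apply, smul_eq_mul, mul_pow]
    rw [← Finset.mul_sum, inv_pow, hsq, inv_mul_cancel₀ hw.ne']
  · rw [Matrix.mulVec_smul]
    simp only [Pi.smul_apply, smul_eq_mul, mul_pow]
    rw [← Finset.mul_sum, inv_pow, hsq]
    field_simp

theorem sum_sq_mulVec_le_kappaPlus (X : Matrix (Fin n) (Fin p) ℝ) {m : ℝ} {w : Fin p → ℝ}
    (hw : ((supp w).card : ℝ) ≤ m) :
    (∑ i, (X *ᵥ w) i ^ 2) / n ≤ kappaPlus X m * ∑ j, w j ^ 2 := by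
  have h0 : 0 ≤ ∑ j, w j ^ 2 := Finset.sum_nonneg fun _ _ => sq_nonneg _
  rcases h0.eq_or_lt with h | h
  · have hw0 : w = 0 := funext fun j => by
      have := (Finset.sum_eq_zero_iff_of_nonneg fun _ _ => sq_nonneg _).1 h.symm j
        (Finset.mem_univ j)
      exact pow_eq_zero_iff (two_ne_zero) |>.1 this
    simp [hw0]
  · obtain ⟨u, hu1, hu2, hu3⟩ := exists_normalized X h
    rw [hu3, mul_div_right_comm]
    exact mul_le_mul_of_nonneg_right
      (le_csSup (bddAbove_kappaPlus X m) ⟨u, ⟨by rwa [hu1], hu2⟩, rfl⟩) h0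

theorem kappa_mul_lt_of_lt_kappaMinus (X : Matrix (Fin n) (Fin p) ℝ) {m κ : ℝ}
    (hκ : 0 ≤ κ) (h : ENNReal.ofReal κ < kappaMinus X m) {w : Fin p → ℝ}
    (hw : ((supp w).card : ℝ) ≤ m) (hw0 : w ≠ 0) :
    κ * ∑ j, w j ^ 2 < (∑ i, (X *ᵥ w) i ^ 2) / n := by
  have hpos : 0 < ∑ j, w j ^ 2 := by
    obtain ⟨j, hj⟩ := Function.ne_iff.1 hw0
    have hj : w j ≠ 0 := hj
    exact Finset.sum_pos' (fun _ _ => sq_nonneg _) ⟨j, Finset.mem_univ j, by positivity⟩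
  obtain ⟨u, hu1, hu2, hu3⟩ := exists_normalized X hpos
  have h1 := h.trans_le (iInf₂_le (f := fun (u : Fin p → ℝ)
    (_ : u ∈ {u : Fin p → ℝ | ((supp u).card : ℝ) ≤ m ∧ ∑ j, u j ^ 2 = 1}) =>
      ENNReal.ofReal ((∑ i, (X *ᵥ u) i ^ 2) / n)) u ⟨by rwa [hu1], hu2⟩)
  rw [ENNReal.ofReal_lt_ofReal_iff_of_nonneg hκ] at h1
  rw [hu3, mul_div_right_comm]
  exact mul_lt_mul_of_pos_right h1 hpos

/-- Restricting `Xᵀ v / n` to few coordinates costs at most `κ₊` in squared norm. -/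
theorem sum_sq_restrict_le (hn : 0 < n) (X : Matrix (Fin n) (Fin p) ℝ) {m : ℝ}
    {A : Finset (Fin p)} (hA : (A.card : ℝ) ≤ m) (v : Fin n → ℝ) :
    ∑ j ∈ A, ((Xᵀ *ᵥ v) j / n) ^ 2 ≤ kappaPlus X m * ((∑ i, v i ^ 2) / n) := by
  classical
  have hn' : (0 : ℝ) < n := Nat.cast_pos.2 hn
  have hV : 0 ≤ ∑ i, v i ^ 2 := Finset.sum_nonneg fun _ _ => sq_nonneg _
  -- Duality: for `w` the restriction of `Xᵀ v` to `A`, `‖w‖² = ⟨v, Xw⟩ ≤ ‖v‖ ‖Xw‖`, and `κ₊` bounds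
  -- `‖Xw‖` by `‖w‖`.
  let w : Fin p → ℝ := fun j => if j ∈ A then (Xᵀ *ᵥ v) j else 0
  have hw2 : ∑ j, w j ^ 2 = ∑ j ∈ A, (Xᵀ *ᵥ v) j ^ 2 := by
    simp [w, ite_pow]
  have hwX : ∑ j, w j ^ 2 = ∑ i, v i * (X *ᵥ w) i := by
    rw [← sum_transpose_mulVec_mul]
    refine Finset.sum_congr rfl fun j _ => ?_
    by_cases hj : j ∈ A <;> simp [w, hj, sq]
  have hcard : ((supp w).card : ℝ) ≤ m := by
    refine le_trans (Nat.cast_le.2 (Finset.card_le_card fun j hj => ?_)) hA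
    by_contra hjA
    simp [supp, w, hjA] at hj
  have h1 := sum_sq_mulVec_le_kappaPlus X hcard
  have h2 := Finset.sum_mul_sq_le_sq_mul_sq Finset.univ v (X *ᵥ w)
  rw [← hwX] at h2
  rw [div_le_iff₀ hn'] at h1
  have h3 : (∑ j, w j ^ 2) ^ 2
      ≤ (∑ i, v i ^ 2) * (kappaPlus X m * (∑ j, w j ^ 2) * n) :=
    h2.trans (mul_le_mul_of_nonneg_left h1 hV)
  have h4 : ∑ j, w j ^ 2 ≤ (∑ i, v i ^ 2) * kappaPlus X m * n := by
    have h0 : 0 ≤ ∑ j, w j ^ 2 := Finset.sum_nonneg fun _ _ => sq_nonneg _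
    rcases h0.eq_or_lt with h | h
    · rw [← h]
      have := kappaPlus_nonneg X m
      positivity
    · refine le_of_mul_le_mul_right ?_ h
      calc (∑ j, w j ^ 2) * ∑ j, w j ^ 2 = (∑ j, w j ^ 2) ^ 2 := (sq _).symm
        _ ≤ _ := h3
        _ = _ := by ring
  simp only [div_pow]
  rw [← Finset.sum_div, ← hw2, div_le_iff₀ (by positivity)]
  calc ∑ j, w j ^ 2 ≤ (∑ i, v i ^ 2) * kappaPlus X m * n := h4
    _ = _ := by field_simp

/-! ### Sparsity of global minimizers -/

theorem lt_abs_of_lt_iInf_pdot (hρ : IsPenalty ρ) {t0 x s d : ℝ}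
    (hx : (x : EReal) < ⨅ s ∈ Set.Ioo 0 t0, ⨅ d ∈ pdot ρ s, (d : EReal))
    (hs : s ≠ 0) (hst : |s| < t0) (hd : d ∈ pdot ρ s) : x < |d| := by
  have key : ∀ s d : ℝ, 0 < s → s < t0 → d ∈ pdot ρ s → x < d := fun s d h1 h2 h3 =>
    EReal.coe_lt_coe_iff.1 (hx.trans_le ((iInf₂_le s ⟨h1, h2⟩).trans (iInf₂_le d h3)))
  rcases lt_or_gt_of_ne hs with h | h
  · rw [abs_of_neg h] at hst
    exact (key (-s) (-d) (neg_pos.2 h) hst (neg_mem_pdot hρ hd)).trans_le (neg_le_abs d)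
  · rw [abs_of_pos h] at hst
    exact (key s d h hst hd).trans_le (le_abs_self d)

/-- For `s > 0` the chord from `s` to `t0` separates the two values; evenness handles `s < 0`. -/
theorem le_abs_of_concave (hρ : IsPenalty ρ) (hc : ConcaveOn ℝ (Set.Ioi 0) ρ) {t0 d0 s d : ℝ}
    (hd0 : d0 ∈ pdot ρ t0) (hs : s ≠ 0) (hst : |s| < t0) (hd : d ∈ pdot ρ s) : d0 ≤ |d| := by
  have key : ∀ s d : ℝ, 0 < s → s < t0 → d ∈ pdot ρ s → d0 ≤ d := fun s d h1 h2 h3 =>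
    (le_chord_of_mem_pdot hc h1 h2 hd0).trans (chord_le_of_mem_pdot hc h1 h2 h3)
  rcases lt_or_gt_of_ne hs with h | h
  · rw [abs_of_neg h] at hst
    exact (key (-s) (-d) (neg_pos.2 h) hst (neg_mem_pdot hρ hd)).trans (neg_le_abs d)
  · rw [abs_of_pos h] at hst
    exact (key s d h hst hd).trans (le_abs_self d)

theorem gradient_eq {X : Matrix (Fin n) (Fin p) ℝ} {β b : Fin p → ℝ} {ε y : Fin n → ℝ}
    (hy : y = X *ᵥ β + ε) (j : Fin p) :
    (Xᵀ *ᵥ (X *ᵥ b - y)) j / n = (Xᵀ *ᵥ (X *ᵥ (b - β))) j / n - (Xᵀ *ᵥ ε) j / n := by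
  have : X *ᵥ b - y = X *ᵥ (b - β) - ε := by
    rw [hy, Matrix.mulVec_sub]
    abel
  rw [this, Matrix.mulVec_sub, Pi.sub_apply, sub_div]

theorem card_mul_le_sum (hρ : IsPenalty ρ) {S J : Finset (Fin p)} (hJ : Disjoint J S) {v : ℝ}
    {b : Fin p → ℝ} (h : ∀ j ∈ J, v ≤ ρ (b j)) : (J.card : ℝ) * v ≤ ∑ j ∈ Sᶜ, ρ (b j) := by
  rw [← nsmul_eq_mul]
  exact (Finset.card_nsmul_le_sum J _ _ h).trans
    (Finset.sum_le_sum_of_subset_of_nonneg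
      (fun j hj => Finset.mem_compl.2 (Finset.disjoint_left.1 hJ hj)) fun _ _ _ => hρ.nonneg _)

theorem valueAt_le (hρ : IsPenalty ρ) {t0 s : ℝ} (h0 : 0 ≤ t0) (hs : s ≠ 0) (h : t0 ≤ |s|) :
    valueAt ρ t0 ≤ ρ s := by
  rw [valueAt]
  split_ifs with ht
  · rw [← hρ.map_abs s]
    exact csInf_le ⟨0, by rintro _ ⟨t, -, rfl⟩; exact hρ.nonneg t⟩ ⟨|s|, abs_pos.2 hs, rfl⟩
  · exact hρ.le_of_abs_le (by rwa [abs_of_nonneg h0])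

theorem card_mul_sq_le (hn : 0 < n) (X : Matrix (Fin n) (Fin p) ℝ) {m c : ℝ} (hc : 0 ≤ c)
    {A : Finset (Fin p)} (hA : (A.card : ℝ) ≤ m) {v : Fin n → ℝ}
    (h : ∀ j ∈ A, c ≤ |(Xᵀ *ᵥ v) j / n|) :
    (A.card : ℝ) * c ^ 2 ≤ 2 * kappaPlus X m * ((∑ i, v i ^ 2) / (2 * n)) := by
  have h1 := sum_sq_restrict_le hn X hA v
  have h2 : (A.card : ℝ) * c ^ 2 ≤ ∑ j ∈ A, ((Xᵀ *ᵥ v) j / n) ^ 2 := by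
    rw [← nsmul_eq_mul]
    refine Finset.card_nsmul_le_sum A _ _ fun j hj => ?_
    rw [← sq_abs ((Xᵀ *ᵥ v) j / n)]
    exact pow_le_pow_left₀ hc (h j hj) 2
  refine (h2.trans h1).trans (le_of_eq ?_)
  field_simp

/-- Otherwise choose exactly `m0` such indices, so that `κ₊(m0)` applies. Each square exceeds `2 κ₊
B / m0`, so their sum exceeds the bound `2 κ₊ B`. -/
theorem card_lt_of_sqrt_lt (hn : 0 < n) (X : Matrix (Fin n) (Fin p) ℝ) {m0 : ℕ} (hm0 : 0 < m0)
    {B : ℝ} {J : Finset (Fin p)} {v : Fin n → ℝ} (hB : (∑ i, v i ^ 2) / (2 * n) ≤ B)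
    (h : ∀ j ∈ J, √(2 * kappaPlus X m0 * B / m0) < |(Xᵀ *ᵥ v) j / n|) : J.card < m0 := by
  by_contra! hJ
  obtain ⟨A, hAJ, hA⟩ := Finset.exists_subset_card_eq hJ
  have hm0' : (0 : ℝ) < m0 := Nat.cast_pos.2 hm0
  have hB0 : 0 ≤ B :=
    le_trans (div_nonneg (Finset.sum_nonneg fun _ _ => sq_nonneg _) (by positivity)) hB
  have hκ := kappaPlus_nonneg X m0
  have h1 := sum_sq_restrict_le hn X (m := m0) (A := A) (by rw [hA]) v
  have h2 : ∑ j ∈ A, √(2 * kappaPlus X m0 * B / m0) ^ 2 < ∑ j ∈ A, ((Xᵀ *ᵥ v) j / n) ^ 2 := by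
    refine Finset.sum_lt_sum_of_nonempty (Finset.card_pos.1 (hA ▸ hm0)) fun j hj => ?_
    rw [← sq_abs ((Xᵀ *ᵥ v) j / n)]
    exact pow_lt_pow_left₀ (h j (hAJ hj)) (Real.sqrt_nonneg _) two_ne_zero
  rw [Real.sq_sqrt (by positivity), Finset.sum_const, hA, nsmul_eq_mul,
    mul_div_cancel₀ _ hm0'.ne'] at h2
  have h3 : kappaPlus X m0 * ((∑ i, v i ^ 2) / n) ≤ 2 * kappaPlus X m0 * B := by
    have : (∑ i, v i ^ 2) / n = 2 * ((∑ i, v i ^ 2) / (2 * n)) := by field_simp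
    rw [this]
    nlinarith
  linarith

/-- The floor in `m` counts entries of size at least `t0`, each costing `ρ(t0)` out of the budget `ξ
Δ`; `m0` counts the smaller ones, where the gradient is large. -/
theorem card_support_le_of_isSparsityBound (hn : 0 < n) (hρ : IsPenalty ρ)
    (hd : LRDifferentiable ρ) {D : EReal} (hD : HasRightSlope ρ 0 D)
    {X : Matrix (Fin n) (Fin p) ℝ} (hX : ∀ j, ∑ i, X i j ^ 2 = n) {β b : Fin p → ℝ}
    {ε y : Fin n → ℝ} (hy : y = X *ᵥ β + ε) {S : Finset (Fin p)} (hS : S = supp β)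
    (hb : IsMinOn (loss X y ρ) Set.univ b) {η m : ℝ} (h0 : 0 < η) (h1 : η < 1)
    (hnull : NullConsistent X ε ρ η) (hne : b ≠ β) (hm : IsSparsityBound X ε ρ S η m) :
    ((supp b \ S).card : ℝ) ≤ m := by
  classical
  obtain ⟨t0, m0, hΔ, hv, hcase, rfl⟩ := hm
  have hle : loss X y ρ b ≤ loss X y ρ β := hb (Set.mem_univ _)
  have hξ := one_lt_xi h0 h1
  have ht0 : 0 ≤ t0 := by rcases hcase with h | h; exacts [h.1.ge, h.1.le]
  have hu : b - β ≠ 0 := sub_ne_zero.2 hne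
  obtain ⟨j0, hj0⟩ := Function.ne_iff.1 hu
  obtain ⟨s, hs⟩ : ∃ s, 0 < ρ s :=
    ⟨_, hv.trans_le (valueAt_le hρ ht0 (s := t0 + 1) (by positivity)
      (by rw [abs_of_nonneg (by positivity)]; linarith))⟩
  have hcone := cone_inequality_strict hn hρ hs hy hS hle h0 h1 hnull hu
  have hcone' := cone_inequality hn hρ hy hS hle h0 h1 hnull
  have hSne : S.Nonempty := by
    rw [Finset.nonempty_iff_ne_empty]
    intro h
    rw [h, Finset.sum_empty, mul_zero] at hcone
    exact absurd hcone (not_lt.2 (Finset.sum_nonneg fun _ _ => hρ.nonneg _))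
  have hgrad : ∀ j, |(Xᵀ *ᵥ (X *ᵥ (b - β))) j / n| ≤ (1 + η) * threshold ρ := by
    intro j
    have e1 := abs_gradient_le_threshold hn hρ hX hb j
    have e2 := hnull.abs_noise_le hn hρ hX h0 j
    rw [gradient_eq hy] at e1
    have e3 := abs_sub_abs_le_abs_sub ((Xᵀ *ᵥ (X *ᵥ (b - β))) j / n) ((Xᵀ *ᵥ ε) j / n)
    linarith
  have hl1 := l1_le_of_cone hn hu hSne (by linarith) (hρ.threshold_pos hs) hcone hgrad
  have hM : ∑ j ∈ S, ρ ((b - β) j) ≤ (DeltaS X ρ S η).toReal := sum_rho_le_Delta hρ hd S _ hl1 hΔ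
  set M := (DeltaS X ρ S η).toReal
  have hcb : ∑ j ∈ Sᶜ, ρ ((b - β) j) = ∑ j ∈ Sᶜ, ρ (b j) := Finset.sum_congr rfl fun j hj => by
    have : β j = 0 := by rw [hS] at hj; simpa [supp] using hj
    rw [Pi.sub_apply, this, sub_zero]
  have hQ0 : 0 ≤ (∑ i, (X *ᵥ (b - β)) i ^ 2) / (2 * n) :=
    div_nonneg (Finset.sum_nonneg fun _ _ => sq_nonneg _) (by positivity)
  have hR0 : 0 ≤ ∑ j ∈ Sᶜ, ρ (b j) := Finset.sum_nonneg fun _ _ => hρ.nonneg _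
  have hbound : (∑ i, (X *ᵥ (b - β)) i ^ 2) / (2 * n) + ∑ j ∈ Sᶜ, ρ (b j) ≤ xi η * M := by
    rw [hcb] at hcone'
    exact hcone'.trans (mul_le_mul_of_nonneg_left hM (by linarith))
  let J1 := (supp b \ S).filter fun j => t0 ≤ |b j|
  let J2 := (supp b \ S).filter fun j => ¬ t0 ≤ |b j|
  have hJ : (supp b \ S).card = J1.card + J2.card :=
    (Finset.card_filter_add_card_filter_not _).symm
  have hb0 : ∀ j ∈ supp b \ S, b j ≠ 0 := fun j hj => by
    simpa [supp] using (Finset.mem_sdiff.1 hj).1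
  have hJ1 : J1.card ≤ ⌊xi η * M / valueAt ρ t0⌋₊ := by
    refine Nat.le_floor ((le_div_iff₀ hv).2 (le_trans ?_ (le_trans (le_add_of_nonneg_left hQ0)
      hbound)))
    refine card_mul_le_sum hρ ?_ fun j hj => ?_
    · exact Finset.disjoint_of_subset_left (Finset.filter_subset _ _) Finset.sdiff_disjoint
    · obtain ⟨e1, e2⟩ := Finset.mem_filter.1 hj
      exact valueAt_le hρ ht0 (hb0 j e1) e2
  have hJ2 : J2.card ≤ m0 := by
    -- For `t0 = 0` no entry is smaller than `t0`. Otherwise the noise is subtracted from `inf ρ̇`,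
    -- leaving the square-root threshold.
    rcases hcase with ⟨rfl, rfl⟩ | ⟨-, hm0, hlt⟩
    · rw [Nat.le_zero, Finset.card_eq_zero, Finset.filter_eq_empty_iff]
      exact fun j _ h => h (abs_nonneg _)
    · refine (card_lt_of_sqrt_lt hn X hm0 (B := xi η * M)
        ((le_add_of_nonneg_right hR0).trans hbound) fun j hj => ?_).le
      obtain ⟨e1, e2⟩ := Finset.mem_filter.1 hj
      have e3 := lt_abs_of_lt_iInf_pdot hρ hlt (hb0 j e1) (not_le.1 e2)
        (neg_gradient_mem_pdot hn hρ hd hD hX hb j)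
      rw [abs_neg, gradient_eq hy] at e3
      have e4 := abs_sub ((Xᵀ *ᵥ (X *ᵥ (b - β))) j / n) ((Xᵀ *ᵥ ε) j / n)
      have e5 : |(Xᵀ *ᵥ ε) j / n| ≤ ‖fun j : Fin p => (Xᵀ *ᵥ ε) j / n‖ :=
        norm_le_pi_norm (fun j : Fin p => (Xᵀ *ᵥ ε) j / n) j
      have e6 : 2 * kappaPlus X m0 * (xi η * M) / m0 = 2 * xi η * kappaPlus X m0 * M / m0 := by
        ring
      rw [e6]
      exact lt_of_add_lt_add_right (e3.trans_le (e4.trans (add_le_add_right e5 _)))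
  rw [hJ]
  push_cast
  rw [add_comm]
  exact add_le_add (Nat.cast_le.2 hJ2) (Nat.cast_le.2 hJ1)

/-- The trade-off between large and small coordinates used for bounded concave penalties. -/
theorem add_le_max_mul {x z k α ξ g q a γ v κ : ℝ} (hξ : 0 < ξ) (hg : 0 < g) (hx : 0 ≤ x)
    (hα : 0 < α) (hq : 0 < q) (hv : v * g = γ) (hγ : 0 < γ)
    (ha : 0 ≤ a) (hbound : a + x * v ≤ ξ * (k * γ)) (hz : z * q ≤ 2 * κ * a)
    (hκγ : 2 * γ * κ / α ≤ q / ξ) : x + z ≤ max α (ξ * g) * k := by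
  have hv' : v = γ / g := (eq_div_iff hg.ne').2 hv
  rw [div_le_div_iff₀ hα hξ] at hκγ
  have h1 : z * q * (γ * ξ) ≤ q * α * (ξ * (k * γ) - x * v) := by
    calc z * q * (γ * ξ) ≤ 2 * κ * a * (γ * ξ) := by gcongr
      _ = (2 * γ * κ * ξ) * a := by ring
      _ ≤ q * α * a := by gcongr
      _ ≤ q * α * (ξ * (k * γ) - x * v) := by gcongr; linarith
  -- With `τ = x / (ξ g) ∈ [0, k]`, this gives `x + z ≤ ξ g τ + α (k - τ)`, a weighted sum of `ξ g`
  -- and `α` with total weight `k`.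
  have h2 : z ≤ α * (k - x / (ξ * g)) := by
    have e : q * α * (ξ * (k * γ) - x * v) = α * (k - x / (ξ * g)) * (q * (γ * ξ)) := by
      rw [hv']
      field_simp
    rw [e] at h1
    refine le_of_mul_le_mul_right (a := q * (γ * ξ)) ?_ (by positivity)
    linarith
  have h3 : 0 ≤ k - x / (ξ * g) := by
    rw [sub_nonneg, div_le_iff₀ (by positivity)]
    have : x * v ≤ ξ * (k * γ) := by linarith
    rw [← hv] at this
    have hvpos : 0 < v := by rw [hv']; positivity
    refine le_of_mul_le_mul_right (a := v) ?_ hvpos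
    linarith
  have h4 : x = ξ * g * (x / (ξ * g)) := by field_simp
  have h5 : 0 ≤ x / (ξ * g) := by positivity
  have h6 := mul_le_mul_of_nonneg_right (le_max_left α (ξ * g)) h3
  have h7 := mul_le_mul_of_nonneg_right (le_max_right α (ξ * g)) h5
  linarith

/-- The budget `‖ρ(u_S)‖₁ ≤ |S| γ* λ²` comes from boundedness alone. Small and large entries draw on
the same budget, so they are traded off rather than bounded separately. -/
theorem card_support_le_of_isSparsityBoundBounded (hn : 0 < n) (hρ : IsPenalty ρ)
    (hd : LRDifferentiable ρ) {D : EReal} (hD : HasRightSlope ρ 0 D)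
    {X : Matrix (Fin n) (Fin p) ℝ} (hX : ∀ j, ∑ i, X i j ^ 2 = n) {β b : Fin p → ℝ}
    {ε y : Fin n → ℝ} (hy : y = X *ᵥ β + ε) {S : Finset (Fin p)} (hS : S = supp β)
    (hb : IsMinOn (loss X y ρ) Set.univ b) {η m lam : ℝ} (hlam : 0 < lam) (h0 : 0 < η)
    (h1 : η < 1) (hnull : NullConsistent X ε ρ η) (hne : b ≠ β)
    (hm : IsSparsityBoundBounded X ρ lam S η m) : ((supp b \ S).card : ℝ) ≤ m := by
  classical
  obtain ⟨γs, a0, a1, γ, α, g, m0, hth, hconc, hbdd, hγs, ha0, ha1, hγ, hηc, ⟨d0, hd0, hd0c⟩,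
    hα, hm0, hκ, hg, hm⟩ := hm
  set c := 1 - a1 / γ
  have hc : 0 < c := h0.trans hηc
  have hle : loss X y ρ b ≤ loss X y ρ β := hb (Set.mem_univ _)
  have hξ := one_lt_xi h0 h1
  have hu : b - β ≠ 0 := sub_ne_zero.2 hne
  obtain ⟨s, hs⟩ := IsPenalty.exists_pos_of_threshold_pos (hth ▸ hlam) hρ
  have hcone := cone_inequality_strict hn hρ hs hy hS hle h0 h1 hnull hu
  have hcone' := cone_inequality hn hρ hy hS hle h0 h1 hnull
  have hSne : S.Nonempty := by
    rw [Finset.nonempty_iff_ne_empty]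
    intro h
    rw [h, Finset.sum_empty, mul_zero] at hcone
    exact absurd hcone (not_lt.2 (Finset.sum_nonneg fun _ _ => hρ.nonneg _))
  have hk : (0 : ℝ) < S.card := Nat.cast_pos.2 hSne.card_pos
  have hle_sup : ∀ t, ρ t ≤ γs * lam ^ 2 := fun t => by
    rw [hγs, div_mul_cancel₀ _ (by positivity)]
    exact le_csSup hbdd ⟨t, rfl⟩
  have hγs0 : 0 < γs := by
    have := hs.trans_le (hle_sup s)
    exact pos_of_mul_pos_left this (by positivity)
  have hg0 : 0 < g := by rw [hg]; positivity
  have hM : ∑ j ∈ S, ρ ((b - β) j) ≤ S.card * (γs * lam ^ 2) := by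
    rw [← nsmul_eq_mul]
    exact Finset.sum_le_card_nsmul _ _ _ fun j _ => hle_sup _
  have hcb : ∑ j ∈ Sᶜ, ρ ((b - β) j) = ∑ j ∈ Sᶜ, ρ (b j) := Finset.sum_congr rfl fun j hj => by
    have : β j = 0 := by rw [hS] at hj; simpa [supp] using hj
    rw [Pi.sub_apply, this, sub_zero]
  have hQ0 : 0 ≤ (∑ i, (X *ᵥ (b - β)) i ^ 2) / (2 * n) :=
    div_nonneg (Finset.sum_nonneg fun _ _ => sq_nonneg _) (by positivity)
  have hbound : (∑ i, (X *ᵥ (b - β)) i ^ 2) / (2 * n) + ∑ j ∈ Sᶜ, ρ (b j)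
      ≤ xi η * (S.card * (γs * lam ^ 2)) := by
    rw [hcb] at hcone'
    exact hcone'.trans (mul_le_mul_of_nonneg_left hM (by linarith))
  set Q := (∑ i, (X *ᵥ (b - β)) i ^ 2) / (2 * n)
  let J1 := (supp b \ S).filter fun j => a0 * lam ≤ |b j|
  let J2 := (supp b \ S).filter fun j => ¬ a0 * lam ≤ |b j|
  have hJ : (supp b \ S).card = J1.card + J2.card :=
    (Finset.card_filter_add_card_filter_not _).symm
  have hb0 : ∀ j ∈ supp b \ S, b j ≠ 0 := fun j hj => by
    simpa [supp] using (Finset.mem_sdiff.1 hj).1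
  have hJ1 : (J1.card : ℝ) * (a0 * c * lam ^ 2) ≤ ∑ j ∈ Sᶜ, ρ (b j) := by
    refine card_mul_le_sum hρ ?_ fun j hj => ?_
    · exact Finset.disjoint_of_subset_left (Finset.filter_subset _ _) Finset.sdiff_disjoint
    · have e1 := mul_le_of_mem_pdot hρ hconc (by positivity) hd0
      have e2 : ρ (a0 * lam) ≤ ρ (b j) := hρ.le_of_abs_le (by
        rw [abs_of_pos (by positivity)]
        exact (Finset.mem_filter.1 hj).2)
      have e3 : lam * c * (a0 * lam) ≤ d0 * (a0 * lam) :=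
        mul_le_mul_of_nonneg_right hd0c (by positivity)
      calc a0 * c * lam ^ 2 = lam * c * (a0 * lam) := by ring
        _ ≤ ρ (b j) := e3.trans (e1.trans e2)
  have hgr : ∀ j ∈ J2, (c - η) * lam ≤ |(Xᵀ *ᵥ (X *ᵥ (b - β))) j / n| := by
    intro j hj
    obtain ⟨e1, e2⟩ := Finset.mem_filter.1 hj
    have e3 := le_abs_of_concave hρ hconc hd0 (hb0 j e1) (not_le.1 e2)
      (neg_gradient_mem_pdot hn hρ hd hD hX hb j)
    rw [abs_neg, gradient_eq hy] at e3
    have e4 := abs_sub ((Xᵀ *ᵥ (X *ᵥ (b - β))) j / n) ((Xᵀ *ᵥ ε) j / n)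
    have e5 := hnull.abs_noise_le hn hρ hX h0 j
    rw [hth] at e5
    linarith
  have hcη : 0 < (c - η) * lam := mul_pos (sub_pos.2 hηc) hlam
  have hκ0 := kappaPlus_nonneg X m0
  have hκ' : 2 * (γs * lam ^ 2) * kappaPlus X m0 / α < ((c - η) * lam) ^ 2 / xi η := by
    have e1 : ((c - η) * lam) ^ 2 / xi η = (c - η) ^ 2 * (1 - η) / (1 + η) * lam ^ 2 := by
      rw [xi]
      have : 1 - η ≠ 0 := by linarith
      have : 1 + η ≠ 0 := by linarith
      field_simp
    have e2 : 2 * (γs * lam ^ 2) * kappaPlus X m0 / α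
        = 2 * γs * kappaPlus X m0 / α * lam ^ 2 := by ring
    rw [e1, e2]
    exact mul_lt_mul_of_pos_right hκ (by positivity)
  -- A crude first count: it allows `κ₊(m0)` to be used on all of `J2` in `hcount`. With more than
  -- `m0 = α |S|` small entries, a subset of size `m0` already contradicts the strict eigenvalue
  -- condition.
  have hJ2 : J2.card ≤ m0 := by
    by_contra! hlt
    obtain ⟨A, hAJ, hA⟩ := Finset.exists_subset_card_eq hlt.le
    have e1 := card_mul_sq_le hn X hcη.le (m := m0) (A := A) (by rw [hA])
      fun j hj => hgr j (hAJ hj)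
    have hR0 : 0 ≤ ∑ j ∈ Sᶜ, ρ (b j) := Finset.sum_nonneg fun _ _ => hρ.nonneg _
    have e2 : 2 * kappaPlus X m0 * Q ≤ 2 * kappaPlus X m0 * (xi η * (S.card * (γs * lam ^ 2))) :=
      mul_le_mul_of_nonneg_left (by linarith) (by positivity)
    rw [div_lt_div_iff₀ hα (by linarith)] at hκ'
    rw [hA] at e1
    have e3 := mul_lt_mul_of_pos_right hκ' hk
    have e4 : (m0 : ℝ) * ((c - η) * lam) ^ 2 = α * S.card * ((c - η) * lam) ^ 2 := by rw [hm0]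
    linarith
  have hcount := card_mul_sq_le hn X hcη.le (m := m0) (Nat.cast_le.2 hJ2) hgr
  have hmax := add_le_max_mul (x := J1.card) (z := J2.card) (k := S.card) (a := Q)
    (v := a0 * c * lam ^ 2) (ξ := xi η) (g := g) (by linarith) hg0 (by positivity) hα
    (pow_pos hcη 2) (by rw [hg]; field_simp) (by positivity) hQ0 (by linarith) hcount hκ'.le
  rw [hJ]
  push_cast
  refine hmax.trans ?_
  -- Here `ξ g ≤ α + g` is the condition `(ξ - 1) g ≤ α`; the other form of `m` dominates the
  -- maximum always.
  rcases hm with ⟨e1, rfl⟩ | rfl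
  · refine mul_le_mul_of_nonneg_right (max_le ?_ ?_) hk.le
    · linarith
    · linarith
  · refine mul_le_mul_of_nonneg_right (max_le ?_ ?_) hk.le
    · have : 0 < xi η * g := by positivity
      linarith
    · linarith

theorem IsSparsityBound.nonneg {X : Matrix (Fin n) (Fin p) ℝ} {ε : Fin n → ℝ}
    {S : Finset (Fin p)} {η m : ℝ} (h : IsSparsityBound X ε ρ S η m) : 0 ≤ m := by
  obtain ⟨t0, m0, -, -, -, rfl⟩ := h
  positivity

theorem IsSparsityBoundBounded.nonneg (hρ : IsPenalty ρ) {X : Matrix (Fin n) (Fin p) ℝ}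
    {S : Finset (Fin p)} {η m lam : ℝ} (h0 : 0 < η) (h1 : η < 1)
    (h : IsSparsityBoundBounded X ρ lam S η m) : 0 ≤ m := by
  obtain ⟨γs, a0, a1, γ, α, g, m0, -, -, -, hγs, ha0, -, -, hc, -, hα, -, -, hg, hm⟩ := h
  have hξ := one_lt_xi h0 h1
  have e1 : 0 ≤ γs := by
    rw [hγs]
    refine div_nonneg (Real.sSup_nonneg ?_) (by positivity)
    rintro _ ⟨t, rfl⟩
    exact hρ.nonneg t
  have e2 : 0 ≤ g := by
    rw [hg]
    exact div_nonneg (by positivity) (by linarith)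
  rcases hm with ⟨-, rfl⟩ | rfl <;> positivity

/-! ### Local solutions that are global -/

/-- Each term in the supremum is nonpositive; multiply it by `|s - t|`. -/
theorem monotone_defect_of_nonconvexity_eq_zero {κ t d s e : ℝ} (h : nonconvexity ρ κ t d = 0)
    (he : e ∈ pdot ρ s) : -((e - d) * (s - t)) ≤ κ * (s - t) ^ 2 := by
  have h1 : ((-Real.sign (s - t) * (e - d) - κ * |s - t| : ℝ) : EReal) ≤ nonconvexity ρ κ t d :=
    le_iSup_of_le s (le_iSup₂_of_le e he le_rfl)
  rw [h, ← EReal.coe_zero, EReal.coe_le_coe_iff] at h1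
  have h2 := mul_le_mul_of_nonneg_right h1 (abs_nonneg (s - t))
  have h3 : Real.sign (s - t) * |s - t| = s - t := by
    rcases lt_trichotomy (s - t) 0 with h | h | h
    · rw [Real.sign_of_neg h, abs_of_neg h]; ring
    · rw [h]; simp
    · rw [Real.sign_of_pos h, abs_of_pos h]; ring
  have h4 : |s - t| * |s - t| = (s - t) ^ 2 := by rw [← sq, sq_abs]
  calc -((e - d) * (s - t)) = -(Real.sign (s - t) * |s - t|) * (e - d) := by rw [h3]; ring
    _ ≤ κ * (|s - t| * |s - t|) := by linarith
    _ = _ := by rw [h4]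

theorem IsApproxLocalWith.gradient_eq_neg {X : Matrix (Fin n) (Fin p) ℝ} {y : Fin n → ℝ}
    {b d : Fin p → ℝ} (h : IsApproxLocalWith X y ρ 0 b d) (j : Fin p) :
    (Xᵀ *ᵥ (X *ᵥ b - y)) j / n = -d j := by
  have h1 : ∑ j, ((Xᵀ *ᵥ (X *ᵥ b - y)) j / n + d j) ^ 2 = 0 :=
    le_antisymm h.2 (Finset.sum_nonneg fun _ _ => sq_nonneg _)
  have := (Finset.sum_eq_zero_iff_of_nonneg fun _ _ => sq_nonneg _).1 h1 j (Finset.mem_univ j)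
  have := pow_eq_zero_iff (two_ne_zero) |>.1 this
  linarith

/-- A sparse local solution with controlled nonconvexity is the global solution. -/
theorem isGlobalSolution_of_local (hn : 0 < n) (hρ : IsPenalty ρ) (hd : LRDifferentiable ρ)
    {D : EReal} (hD : HasRightSlope ρ 0 D) {X : Matrix (Fin n) (Fin p) ℝ}
    (hX : ∀ j, ∑ i, X i j ^ 2 = n) {β b d : Fin p → ℝ} {ε y : Fin n → ℝ}
    (hy : y = X *ᵥ β + ε) {S : Finset (Fin p)} (hS : S = supp β) {η m κ lam : ℝ}
    (hlam : 0 < lam) (h0 : 0 < η) (h1 : η < 1) (hnull : NullConsistent X ε ρ η)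
    (hm : IsSparsityBound X ε ρ S η m ∨ IsSparsityBoundBounded X ρ lam S η m) (hκ : 0 ≤ κ)
    (hκm : ENNReal.ofReal κ < kappaMinus X (m + S.card)) (hb : IsApproxLocalWith X y ρ 0 b d)
    (hbS : ∀ j, j ∉ S → b j = 0) (hθ : ∀ j, nonconvexity ρ κ (b j) (d j) = 0) :
    IsGlobalSolution X y ρ b := by
  classical
  have huniq : ∀ b', IsMinOn (loss X y ρ) Set.univ b' → b' = b := by
    intro b' hb'
    by_contra hne
    -- The counting arguments need `b' - β ≠ 0`; for `b' = β` there are no entries off `S`.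
    have hcard : ((supp b' \ S).card : ℝ) ≤ m := by
      by_cases hβ : b' = β
      · rw [hβ, ← hS, Finset.sdiff_self, Finset.card_empty, Nat.cast_zero]
        rcases hm with h | h
        exacts [h.nonneg, h.nonneg hρ h0 h1]
      · rcases hm with h | h
        · exact card_support_le_of_isSparsityBound hn hρ hd hD hX hy hS hb' h0 h1 hnull hβ h
        · exact card_support_le_of_isSparsityBoundBounded hn hρ hd hD hX hy hS hb' hlam h0 h1
            hnull hβ h
    have hsupp : ((supp (b' - b)).card : ℝ) ≤ m + S.card := by
      have e1 : supp (b' - b) ⊆ (supp b' \ S) ∪ S := by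
        intro j hj
        by_cases hjS : j ∈ S
        · exact Finset.mem_union_right _ hjS
        · refine Finset.mem_union_left _ (Finset.mem_sdiff.2 ⟨?_, hjS⟩)
          simpa [supp, hbS j hjS] using hj
      have e2 := (Finset.card_le_card e1).trans (Finset.card_union_le _ _)
      have e3 : ((supp (b' - b)).card : ℝ) ≤ (supp b' \ S).card + S.card := by exact_mod_cast e2
      linarith
    have h2 := kappa_mul_lt_of_lt_kappaMinus X hκ hκm hsupp (sub_ne_zero.2 hne)
    have h3 : (∑ i, (X *ᵥ (b' - b)) i ^ 2) / n
        = ∑ j, ((Xᵀ *ᵥ (X *ᵥ b' - y)) j / n - (Xᵀ *ᵥ (X *ᵥ b - y)) j / n) * (b' - b) j := by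
      have e1 : ∀ j, (Xᵀ *ᵥ (X *ᵥ b' - y)) j - (Xᵀ *ᵥ (X *ᵥ b - y)) j
          = (Xᵀ *ᵥ (X *ᵥ (b' - b))) j := fun j => by
        rw [← Pi.sub_apply, ← Matrix.mulVec_sub, sub_sub_sub_cancel_right, ← Matrix.mulVec_sub]
      simp only [← sub_div, e1, div_mul_eq_mul_div]
      rw [← Finset.sum_div, sum_transpose_mulVec_mul]
      simp only [sq]
    have h4 : (∑ i, (X *ᵥ (b' - b)) i ^ 2) / n ≤ κ * ∑ j, (b' - b) j ^ 2 := by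
      rw [h3, Finset.mul_sum]
      refine Finset.sum_le_sum fun j _ => ?_
      have := monotone_defect_of_nonconvexity_eq_zero (hθ j)
        (neg_gradient_mem_pdot hn hρ hd hD hX hb' j)
      rw [hb.gradient_eq_neg j, Pi.sub_apply]
      linarith
    linarith
  -- Uniqueness only says that any minimizer equals `b`; existence is what makes `b` a minimizer.
  obtain ⟨b0, hb0⟩ := exists_isMinOn_loss hn hρ hd X y
  exact ⟨huniq b0 hb0 ▸ hb0, huniq⟩

/-! ### The oracle estimator -/

theorem mulVec_eq_cols_mulVec (X : Matrix (Fin n) (Fin p) ℝ) {S : Finset (Fin p)}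
    {f : Fin p → ℝ} (hf : ∀ j, j ∉ S → f j = 0) :
    X *ᵥ f = cols X S *ᵥ (fun j : {j // j ∈ S} => f j) := by
  ext i
  simp only [Matrix.mulVec, dotProduct, cols, Matrix.submatrix_apply, id]
  rw [Finset.sum_coe_sort S fun j => X i j * f j]
  exact (Finset.sum_subset (Finset.subset_univ S) fun j _ hj => by rw [hf j hj, mul_zero]).symm

theorem cols_transpose_mulVec (X : Matrix (Fin n) (Fin p) ℝ) (S : Finset (Fin p))
    (w : Fin n → ℝ) (j : {j // j ∈ S}) : ((cols X S)ᵀ *ᵥ w) j = (Xᵀ *ᵥ w) j := rfl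

theorem oracle_of_notMem (X : Matrix (Fin n) (Fin p) ℝ) (y : Fin n → ℝ) {S : Finset (Fin p)}
    {j : Fin p} (hj : j ∉ S) : oracle X y S j = 0 := by simp [oracle, hj]

theorem cols_mulVec_mem_colSpace (X : Matrix (Fin n) (Fin p) ℝ) (S : Finset (Fin p))
    (v : {j // j ∈ S} → ℝ) : WithLp.toLp 2 (cols X S *ᵥ v) ∈ colSpace X S := by
  have : WithLp.toLp 2 (cols X S *ᵥ v)
      = ∑ j : {j // j ∈ S}, v j • WithLp.toLp 2 (fun i => X i j) := by
    ext i
    simp [Matrix.mulVec, dotProduct, cols, mul_comm]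
  rw [this]
  exact Submodule.sum_mem _ fun j _ =>
    Submodule.smul_mem _ _ (Submodule.subset_span ⟨j, j.2, rfl⟩)

theorem mem_orthogonal_colSpace (X : Matrix (Fin n) (Fin p) ℝ) (S : Finset (Fin p))
    {w : Fin n → ℝ} (hw : ∀ j ∈ S, (Xᵀ *ᵥ w) j = 0) :
    WithLp.toLp 2 w ∈ (colSpace X S)ᗮ := by
  have : colSpace X S ≤ (Submodule.span ℝ {WithLp.toLp 2 w})ᗮ := by
    refine Submodule.span_le.2 ?_
    rintro _ ⟨j, hj, rfl⟩
    rw [SetLike.mem_coe, Submodule.mem_orthogonal_singleton_iff_inner_right]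
    have := hw j hj
    simpa [Matrix.mulVec, dotProduct, PiLp.inner_apply] using this
  exact (Submodule.le_orthogonal_iff_le_orthogonal.1 this) (Submodule.mem_span_singleton_self _)

theorem gram_mulVec (X : Matrix (Fin n) (Fin p) ℝ) (S : Finset (Fin p))
    (v : {j // j ∈ S} → ℝ) : gram X S *ᵥ v = (cols X S)ᵀ *ᵥ (cols X S *ᵥ v) := by
  rw [gram, Matrix.mulVec_mulVec]

theorem transpose_mulVec_residual (X : Matrix (Fin n) (Fin p) ℝ) (y : Fin n → ℝ)
    {S : Finset (Fin p)} (hgram : IsUnit (gram X S).det) {j : Fin p} (hj : j ∈ S) :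
    (Xᵀ *ᵥ (y - X *ᵥ oracle X y S)) j = 0 := by
  have h1 : (cols X S)ᵀ *ᵥ (X *ᵥ oracle X y S) = (cols X S)ᵀ *ᵥ y := by
    rw [mulVec_eq_cols_mulVec X fun j => oracle_of_notMem X y, ← gram_mulVec]
    have : (fun j : {j // j ∈ S} => oracle X y S j)
        = (gram X S)⁻¹ *ᵥ ((cols X S)ᵀ *ᵥ y) := by
      ext j
      simp [oracle]
    rw [this, Matrix.mulVec_mulVec, Matrix.mul_nonsing_inv _ hgram, Matrix.one_mulVec]
  rw [Matrix.mulVec_sub, Pi.sub_apply, sub_eq_zero]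
  exact (congrFun h1 ⟨j, hj⟩).symm

/-- By the normal equations the residual is orthogonal to the column space, and `ε` minus it is
`X(β̂ᵒ - β)`, which lies in that space. These two properties characterize the projection. -/
theorem residual_eq_projPerp {X : Matrix (Fin n) (Fin p) ℝ} {β : Fin p → ℝ} {ε y : Fin n → ℝ}
    (hy : y = X *ᵥ β + ε) {S : Finset (Fin p)} (hS : S = supp β)
    (hgram : IsUnit (gram X S).det) : y - X *ᵥ oracle X y S = projPerp X S ε := by
  have hβ : ∀ j, j ∉ S → β j = 0 := fun j hj => by rw [hS] at hj; simpa [supp] using hj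
  have h1 := mem_orthogonal_colSpace X S fun j hj => transpose_mulVec_residual X y hgram hj
  have h2 : WithLp.toLp 2 ε - WithLp.toLp 2 (y - X *ᵥ oracle X y S) ∈ (colSpace X S)ᗮᗮ := by
    refine Submodule.le_orthogonal_orthogonal _ ?_
    have e : WithLp.toLp 2 ε - WithLp.toLp 2 (y - X *ᵥ oracle X y S)
        = WithLp.toLp 2 (X *ᵥ (oracle X y S - β)) := by
      rw [← WithLp.toLp_sub, hy, Matrix.mulVec_sub]
      congr 1
      abel
    rw [e, mulVec_eq_cols_mulVec X (S := S) fun j hj => by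
      rw [Pi.sub_apply, oracle_of_notMem X y hj, hβ j hj, sub_zero]]
    exact cols_mulVec_mem_colSpace X S _
  have h3 := Submodule.eq_starProjection_of_mem_orthogonal h1 h2
  ext i
  rw [projPerp, h3]

/-- The oracle estimator is an approximate local solution. -/
theorem isApproxLocal_oracle (hρ : IsPenalty ρ) {D : EReal} (hD : HasRightSlope ρ 0 D)
    {X : Matrix (Fin n) (Fin p) ℝ} {β : Fin p → ℝ} {ε y : Fin n → ℝ}
    (hy : y = X *ᵥ β + ε) {S : Finset (Fin p)} (hS : S = supp β)
    (hgram : IsUnit (gram X S).det)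
    (hnoise : ((‖fun j : {j // j ∈ Sᶜ} => (Xᵀ *ᵥ projPerp X S ε) j / n‖ : ℝ) : EReal) ≤ D)
    {d : Fin p → ℝ} (hd : ∀ j ∈ S, d j ∈ pdot ρ (oracle X y S j)) :
    IsApproxLocal X y ρ (∑ j ∈ S, d j ^ 2) (oracle X y S) := by
  have hres : X *ᵥ oracle X y S - y = -projPerp X S ε := by
    rw [← residual_eq_projPerp hy hS hgram, neg_sub]
  have hgrad : ∀ j, (Xᵀ *ᵥ (X *ᵥ oracle X y S - y)) j = -(Xᵀ *ᵥ projPerp X S ε) j := fun j => by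
    rw [hres, Matrix.mulVec_neg, Pi.neg_apply]
  have hgradS : ∀ j ∈ S, (Xᵀ *ᵥ projPerp X S ε) j = 0 := fun j hj => by
    rw [← residual_eq_projPerp hy hS hgram]
    exact transpose_mulVec_residual X y hgram hj
  -- Off `S` the value cancels the gradient exactly; on `S` the gradient vanishes, so the excess is
  -- `∑ d_j²`.
  refine ⟨fun j => if j ∈ S then d j else (Xᵀ *ᵥ projPerp X S ε) j / n, fun j => ?_, ?_⟩
  · by_cases hj : j ∈ S
    · simpa [hj] using hd j hj
    · simp only [hj, if_false]
      rw [oracle_of_notMem X y hj]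
      refine mem_pdot_zero hρ hD (le_trans (EReal.coe_le_coe_iff.2 ?_) hnoise)
      exact norm_le_pi_norm (fun j : {j // j ∈ Sᶜ} => (Xᵀ *ᵥ projPerp X S ε) j / n)
        ⟨j, Finset.mem_compl.2 hj⟩
  · rw [← Finset.sum_add_sum_compl S]
    have h1 : ∑ j ∈ Sᶜ, ((Xᵀ *ᵥ (X *ᵥ oracle X y S - y)) j / n
        + if j ∈ S then d j else (Xᵀ *ᵥ projPerp X S ε) j / n) ^ 2 = 0 :=
      Finset.sum_eq_zero fun j hj => by
        rw [if_neg (Finset.mem_compl.1 hj), hgrad]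
        ring
    rw [h1, add_zero]
    refine Finset.sum_le_sum fun j hj => ?_
    simp only [if_pos hj]
    rw [hgrad, hgradS j hj]
    simp

/-! ### Zeros of gradient maps on a box -/

/-- If `v ↦ -G⁻¹ r(v)` maps a box to itself, where `G` is positive definite and `r` acts
coordinatewise, then it has a fixed point there: the minimizer over the box of the potential of
`G v + r(v)`. -/
theorem exists_mulVec_add_eq_zero {ι : Type*} [Fintype ι] [DecidableEq ι] {G : Matrix ι ι ℝ}
    (hsymm : Gᵀ = G) (hpos : ∀ v, v ⬝ᵥ (G *ᵥ v) ≤ 0 → v = 0) (hdet : IsUnit G.det)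
    {r : ι → ℝ → ℝ} (hr : ∀ j, Continuous (r j)) {C : ℝ} (hC : 0 ≤ C)
    (hmaps : ∀ v : ι → ℝ, ‖v‖ ≤ C → ‖G⁻¹ *ᵥ (fun j => r j (v j))‖ ≤ C) :
    ∃ v : ι → ℝ, ‖v‖ ≤ C ∧ ∀ j, (G *ᵥ v) j + r j (v j) = 0 := by
  let F : (ι → ℝ) → ℝ := fun v => (v ⬝ᵥ (G *ᵥ v)) / 2 + ∑ j, ∫ x in (0 : ℝ)..v j, r j x
  have hderiv : ∀ j a, HasDerivAt (fun a => ∫ x in (0 : ℝ)..a, r j x) (r j a) a := fun j a =>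
    intervalIntegral.integral_hasDerivAt_right ((hr j).intervalIntegrable _ _)
      ((hr j).stronglyMeasurableAtFilter _ _) (hr j).continuousAt
  have hcont : Continuous F := by
    refine Continuous.add ?_ (continuous_finsetSum _ fun j _ => ?_)
    · have : Continuous fun v : ι → ℝ => v ⬝ᵥ (G *ᵥ v) := by
        simp only [dotProduct, Matrix.mulVec]
        fun_prop
      exact this.div_const 2
    · have h1 : Continuous fun a => ∫ x in (0 : ℝ)..a, r j x :=
        continuous_iff_continuousAt.2 fun a => (hderiv j a).continuousAt
      exact h1.comp (continuous_apply j)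
  obtain ⟨v, hv, hmin⟩ := (isCompact_closedBall (0 : ι → ℝ) C).exists_isMinOn
    ⟨0, by simpa using hC⟩ hcont.continuousOn
  rw [mem_closedBall_zero_iff] at hv
  -- The image of the minimizer under the self-map; the segment from `v` to `w` stays in the box, so
  -- the derivative of `F` along it is nonnegative.
  let w : ι → ℝ := -(G⁻¹ *ᵥ (fun j => r j (v j)))
  have hw : ‖w‖ ≤ C := by
    rw [norm_neg]
    exact hmaps v hv
  have hGw : G *ᵥ w = -fun j => r j (v j) := by
    rw [Matrix.mulVec_neg, Matrix.mulVec_mulVec, Matrix.mul_nonsing_inv _ hdet,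
      Matrix.one_mulVec]
  let d := w - v
  have hexp : ∀ t : ℝ, (v + t • d) ⬝ᵥ (G *ᵥ (v + t • d))
      = v ⬝ᵥ (G *ᵥ v) + 2 * t * (d ⬝ᵥ (G *ᵥ v)) + t ^ 2 * (d ⬝ᵥ (G *ᵥ d)) := by
    intro t
    have e : v ⬝ᵥ (G *ᵥ d) = d ⬝ᵥ (G *ᵥ v) := by
      rw [Matrix.dotProduct_mulVec, ← Matrix.mulVec_transpose, hsymm, dotProduct_comm]
    rw [Matrix.mulVec_add, Matrix.mulVec_smul, dotProduct_add, add_dotProduct, add_dotProduct,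
      dotProduct_smul, dotProduct_smul, smul_dotProduct, smul_dotProduct, e]
    simp only [smul_eq_mul]
    ring
  have hF : HasDerivAt (fun t : ℝ => F (v + t • d))
      (d ⬝ᵥ (G *ᵥ v) + ∑ j, r j (v j) * d j) 0 := by
    refine HasDerivAt.add ?_ (HasDerivAt.fun_sum fun j _ => ?_)
    · change HasDerivAt (fun t : ℝ => ((v + t • d) ⬝ᵥ (G *ᵥ (v + t • d))) / 2) _ _
      simp only [hexp]
      have h1 : HasDerivAt (fun t : ℝ => t) 1 0 := hasDerivAt_id 0
      have h2 := ((((h1.const_mul 2).mul_const (d ⬝ᵥ (G *ᵥ v))).const_add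
        (v ⬝ᵥ (G *ᵥ v))).add ((h1.pow 2).mul_const (d ⬝ᵥ (G *ᵥ d)))).div_const 2
      refine h2.congr_deriv ?_
      simp
    · have h1 : HasDerivAt (fun t : ℝ => v j + t * d j) (d j) 0 := by
        simpa using ((hasDerivAt_id (0 : ℝ)).mul_const (d j)).const_add (v j)
      have h2 : HasDerivAt (fun a => ∫ x in (0 : ℝ)..a, r j x) (r j (v j)) (v j + 0 * d j) := by
        simpa using hderiv j (v j)
      exact h2.comp (0 : ℝ) h1
  have hge : 0 ≤ d ⬝ᵥ (G *ᵥ v) + ∑ j, r j (v j) * d j := by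
    have hslope := hF.tendsto_slope.mono_left
      (nhdsWithin_mono (0 : ℝ) (fun t (ht : 0 < t) => ht.ne') : 𝓝[>] (0 : ℝ) ≤ 𝓝[≠] 0)
    refine ge_of_tendsto hslope ?_
    filter_upwards [self_mem_nhdsWithin,
      mem_nhdsWithin_of_mem_nhds (Iio_mem_nhds one_pos)] with t ht ht1
    have ht : 0 < t := ht
    have ht1 : t < 1 := ht1
    have hmem : v + t • d ∈ Metric.closedBall (0 : ι → ℝ) C := by
      have h1 : v + t • d = (1 - t) • v + t • w := by
        simp only [d, smul_sub, sub_smul, one_smul]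
        abel
      rw [h1]
      exact convex_closedBall (0 : ι → ℝ) C (by simpa using hv) (by simpa using hw)
        (sub_nonneg.2 ht1.le) ht.le (by ring)
    have h2 : F v ≤ F (v + t • d) := hmin hmem
    rw [slope_def_field, zero_smul, add_zero, sub_zero]
    exact div_nonneg (sub_nonneg.2 h2) ht.le
  -- Since `r(v) = -G w`, the directional derivative is `-dᵀ G d`. Being nonnegative, it forces `d =
  -- 0`, even if `v` lies on the boundary of the box.
  have hd0 : d ⬝ᵥ (G *ᵥ v) + ∑ j, r j (v j) * d j = -(d ⬝ᵥ (G *ᵥ d)) := by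
    have h1 : ∑ j, r j (v j) * d j = -(d ⬝ᵥ (G *ᵥ w)) := by
      rw [hGw, dotProduct_neg, neg_neg, dotProduct]
      exact Finset.sum_congr rfl fun j _ => mul_comm _ _
    rw [h1]
    simp only [d, Matrix.mulVec_sub, dotProduct_sub]
    ring
  have hd : d = 0 := hpos d (by linarith)
  have hvw : w = v := sub_eq_zero.1 hd
  refine ⟨v, hv, fun j => ?_⟩
  rw [← hvw, hGw, hvw]
  simp

/-! ### A local solution near the oracle estimator -/

theorem inv_smul_gram_mulVec (hn : 0 < n) (X : Matrix (Fin n) (Fin p) ℝ) {S : Finset (Fin p)}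
    (hgram : IsUnit (gram X S).det) (f : {j // j ∈ S} → ℝ) :
    ((n : ℝ)⁻¹ • gram X S)⁻¹ *ᵥ f = (n : ℝ) • ((gram X S)⁻¹ *ᵥ f) := by
  have hn' : (n : ℝ) ≠ 0 := Nat.cast_ne_zero.2 hn.ne'
  have h : ((n : ℝ)⁻¹ • gram X S)⁻¹ = (n : ℝ) • (gram X S)⁻¹ := by
    refine Matrix.inv_eq_right_inv ?_
    rw [Matrix.smul_mul, Matrix.mul_smul, smul_smul, inv_mul_cancel₀ hn', one_smul,
      Matrix.mul_nonsing_inv _ hgram]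
  rw [h, Matrix.smul_mulVec]

/-- The infimum defining `θ₁` is attained: a vector in the box for `θ₁` lies in the box for every
`θ` of the set, and the bounds `θ l` pass to the infimum. -/
theorem norm_le_of_theta1 {X : Matrix (Fin n) (Fin p) ℝ} {S : Finset (Fin p)} {l : ℝ}
    (hl : 0 ≤ l) {r : ℝ → ℝ} {b : Fin p → ℝ} (hne : (theta1Set X S l r b).Nonempty)
    {v : {j // j ∈ S} → ℝ} (hv : ‖v‖ ≤ theta1 X S l r b * l) :
    ‖((n : ℝ)⁻¹ • gram X S)⁻¹ *ᵥ (fun j => r (v j + b j))‖ ≤ theta1 X S l r b * l := by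
  have hbdd : BddBelow (theta1Set X S l r b) := ⟨0, fun θ hθ => hθ.1⟩
  have key : ∀ θ ∈ theta1Set X S l r b,
      ‖((n : ℝ)⁻¹ • gram X S)⁻¹ *ᵥ (fun j => r (v j + b j))‖ ≤ θ * l := fun θ hθ =>
    hθ.2 v (hv.trans (mul_le_mul_of_nonneg_right (csInf_le hbdd hθ) hl))
  rcases hl.eq_or_lt with h | h
  · obtain ⟨θ, hθ⟩ := hne
    have := key θ hθ
    rw [← h, mul_zero] at this ⊢
    exact this
  · rw [← div_le_iff₀ h]
    exact le_csInf hne fun θ hθ => (div_le_iff₀ h).2 (key θ hθ)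

theorem theta1_nonneg {X : Matrix (Fin n) (Fin p) ℝ} {S : Finset (Fin p)} {l : ℝ}
    {r : ℝ → ℝ} {b : Fin p → ℝ} : 0 ≤ theta1 X S l r b :=
  Real.sInf_nonneg fun _ hθ => hθ.1

/-- The supremum must be shown finite. The `θ₁` bound confines `(X_Sᵀ X_S / n)⁻¹ ρ̇` to a compact
ball, on which the remaining map is continuous. -/
theorem norm_le_theta2_mul (hn : 0 < n) {X : Matrix (Fin n) (Fin p) ℝ} {S : Finset (Fin p)}
    (hgram : IsUnit (gram X S).det) {l : ℝ} (hl : 0 < l) {r : ℝ → ℝ} {b : Fin p → ℝ}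
    (hne : (theta1Set X S l r b).Nonempty)
    {v : {j // j ∈ S} → ℝ} (hv : ‖v‖ ≤ theta1 X S l r b * l) :
    ‖(cols X Sᶜ)ᵀ *ᵥ (cols X S *ᵥ ((gram X S)⁻¹ *ᵥ (fun j => r (v j + b j))))‖
      ≤ theta2 X S l r b * l := by
  rw [← div_le_iff₀ hl]
  refine le_csSup ?_ ⟨v, hv, rfl⟩
  have hcont : Continuous fun x : {j // j ∈ S} → ℝ =>
      ‖(cols X Sᶜ)ᵀ *ᵥ (cols X S *ᵥ ((n : ℝ)⁻¹ • x))‖ / l := by fun_prop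
  refine ((isCompact_closedBall (0 : {j // j ∈ S} → ℝ)
    (theta1 X S l r b * l)).bddAbove_image hcont.continuousOn).mono ?_
  rintro _ ⟨v, hv, rfl⟩
  refine ⟨((n : ℝ)⁻¹ • gram X S)⁻¹ *ᵥ (fun j => r (v j + b j)),
    mem_closedBall_zero_iff.2 (norm_le_of_theta1 hl.le hne hv), ?_⟩
  simp only
  rw [inv_smul_gram_mulVec hn X hgram, inv_smul_smul₀ (Nat.cast_ne_zero.2 hn.ne')]

theorem sign_add_of_abs_lt {a v : ℝ} (h : |v| < |a|) : Real.sign (a + v) = Real.sign a := by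
  rcases lt_trichotomy a 0 with ha | rfl | ha
  · rw [abs_of_neg ha, abs_lt] at h
    rw [Real.sign_of_neg ha, Real.sign_of_neg (by linarith)]
  · rw [abs_zero] at h
    exact absurd h (not_lt.2 (abs_nonneg v))
  · rw [abs_of_pos ha, abs_lt] at h
    rw [Real.sign_of_pos ha, Real.sign_of_pos (by linarith)]

theorem eq_zero_of_gram_dotProduct_le (X : Matrix (Fin n) (Fin p) ℝ) {S : Finset (Fin p)}
    (hgram : IsUnit (gram X S).det) {v : {j // j ∈ S} → ℝ} (hv : v ⬝ᵥ (gram X S *ᵥ v) ≤ 0) :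
    v = 0 := by
  have h1 : v ⬝ᵥ (gram X S *ᵥ v) = (cols X S *ᵥ v) ⬝ᵥ (cols X S *ᵥ v) := by
    rw [gram_mulVec, Matrix.dotProduct_mulVec, Matrix.vecMul_transpose]
  have h2 : cols X S *ᵥ v = 0 := by
    rw [h1] at hv
    exact dotProduct_self_eq_zero.1
      (le_antisymm hv (Finset.sum_nonneg fun _ _ => mul_self_nonneg _))
  have h3 : gram X S *ᵥ v = 0 := by rw [gram_mulVec, h2, Matrix.mulVec_zero]
  have h4 := congrArg (fun x => (gram X S)⁻¹ *ᵥ x) h3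
  simpa [Matrix.mulVec_mulVec, Matrix.nonsing_inv_mul _ hgram] using h4

theorem exists_isApproxLocal_near_oracle (hn : 0 < n) (hρ : IsPenalty ρ)
    {X : Matrix (Fin n) (Fin p) ℝ} {β : Fin p → ℝ} {ε y : Fin n → ℝ}
    (hy : y = X *ᵥ β + ε) {S : Finset (Fin p)} (hS : S = supp β)
    (hgram : IsUnit (gram X S).det) {βo : Fin p → ℝ} (hβo : βo = oracle X y S)
    {l : ℝ} (hl : l = threshold ρ) {r : ℝ → ℝ} (hr : ∀ t, r t ∈ pdot ρ t)
    {θ₁ θ₂ : ℝ} (hne : (theta1Set X S l r βo).Nonempty)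
    (hθ₁ : θ₁ = theta1 X S l r βo) (hθ₂ : θ₂ = theta2 X S l r βo)
    (hunif : UniformContinuousOn r (⋃ j ∈ S, Set.Icc (βo j - θ₁ * l) (βo j + θ₁ * l)))
    (hsign : ∀ j, Real.sign (βo j) = Real.sign (β j))
    (hmin : ∀ j ∈ S, θ₁ * l < |βo j|) (hθ₂1 : θ₂ < 1)
    (hnoise : ‖fun j : Fin p => (Xᵀ *ᵥ projPerp X S ε) j / n‖ / (1 - θ₂) ≤ l) :
    ∃ b : Fin p → ℝ, IsApproxLocal X y ρ 0 b ∧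
      (∀ j, Real.sign (b j) = Real.sign (β j)) ∧ ‖b - βo‖ ≤ θ₁ * l := by
  have hn' : (0 : ℝ) < n := Nat.cast_pos.2 hn
  have hl0 : 0 ≤ l := hl ▸ hρ.threshold_nonneg
  have hθ₁0 : 0 ≤ θ₁ := hθ₁ ▸ theta1_nonneg
  set C := θ₁ * l
  have hC : 0 ≤ C := mul_nonneg hθ₁0 hl0
  obtain ⟨a, D, -, hD, -⟩ := hr 0
  -- The chosen `ρ̇` is continuous only on the intervals around `β̂ᵒ`. Clamping its argument to
  -- `[-C, C]` gives continuity on the whole line and changes nothing on the box.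
  have hclamp : ∀ x : ℝ, |x| ≤ C → max (-C) (min C x) = x := fun x hx => by
    obtain ⟨h1, h2⟩ := abs_le.1 hx
    rw [min_eq_right h2, max_eq_right h1]
  have hcoord : ∀ v : {j // j ∈ S} → ℝ, ‖v‖ ≤ C → ∀ j, |v j| ≤ C := fun v hv j =>
    (norm_le_pi_norm v j).trans hv
  have hclampv : ∀ v : {j // j ∈ S} → ℝ, ‖v‖ ≤ C →
      (fun j => r (max (-C) (min C (v j)) + βo j)) = fun j => r (v j + βo j) := fun v hv => by
    ext j
    rw [hclamp _ (hcoord v hv j)]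
  obtain ⟨v, hv, hzero⟩ := exists_mulVec_add_eq_zero (G := (n : ℝ)⁻¹ • gram X S)
    (r := fun (j : {j // j ∈ S}) x => r (max (-C) (min C x) + βo j)) (C := C)
    (by rw [Matrix.transpose_smul, gram, Matrix.transpose_mul, Matrix.transpose_transpose])
    (fun v hv => by
      rw [Matrix.smul_mulVec, dotProduct_smul, smul_eq_mul] at hv
      exact eq_zero_of_gram_dotProduct_le X hgram
        (nonpos_of_mul_nonpos_right hv (inv_pos.2 hn')))
    (by
      rw [Matrix.det_smul]
      exact (IsUnit.mk0 _ (by positivity)).mul hgram)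
    (fun j => by
      refine hunif.continuousOn.comp_continuous (by fun_prop) fun x => ?_
      refine Set.mem_biUnion j.2 ⟨?_, ?_⟩
      · have := le_max_left (-C) (min C x)
        linarith
      · have : max (-C) (min C x) ≤ C := max_le (by linarith) (min_le_left _ _)
        linarith)
    hC
    (fun v hv => by
      simp only [hclampv v hv]
      have := norm_le_of_theta1 hl0 hne (v := v) (by rw [← hθ₁]; exact hv)
      rwa [← hθ₁] at this)
  have hzero' : ∀ j, (((n : ℝ)⁻¹ • gram X S) *ᵥ v) j = -r (v j + βo j) := fun j => by
    have := hzero j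
    rw [hclamp _ (hcoord v hv j)] at this
    linarith
  have hGv : gram X S *ᵥ v = -((n : ℝ) • fun j : {j // j ∈ S} => r (v j + βo j)) := by
    ext j
    have := hzero' j
    rw [Matrix.smul_mulVec, Pi.smul_apply, smul_eq_mul, inv_mul_eq_div, div_eq_iff hn'.ne'] at this
    rw [this, Pi.neg_apply, Pi.smul_apply, smul_eq_mul]
    ring
  have hvinv : v = -((n : ℝ) • ((gram X S)⁻¹ *ᵥ fun j : {j // j ∈ S} => r (v j + βo j))) := by
    rw [← Matrix.mulVec_smul, ← Matrix.mulVec_neg, ← hGv, Matrix.mulVec_mulVec,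
      Matrix.nonsing_inv_mul _ hgram, Matrix.one_mulVec]
  let w : Fin p → ℝ := fun j => if h : j ∈ S then v ⟨j, h⟩ else 0
  have hwS : ∀ j, j ∉ S → w j = 0 := fun j hj => by simp [w, hj]
  have hwv : (fun j : {j // j ∈ S} => w j) = v := by
    ext j
    simp [w]
  have hwC : ∀ j, |w j| ≤ C := fun j => by
    by_cases hj : j ∈ S
    · simpa [w, hj] using hcoord v hv ⟨j, hj⟩
    · simpa [w, hj] using hC
  have hgrad : ∀ j, (Xᵀ *ᵥ (X *ᵥ (βo + w) - y)) j
      = (Xᵀ *ᵥ (cols X S *ᵥ v)) j - (Xᵀ *ᵥ projPerp X S ε) j := fun j => by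
    have h1 : X *ᵥ (βo + w) - y = cols X S *ᵥ v - projPerp X S ε := by
      rw [← residual_eq_projPerp hy hS hgram, ← hβo, Matrix.mulVec_add,
        mulVec_eq_cols_mulVec X hwS, hwv]
      abel
    rw [h1, Matrix.mulVec_sub, Pi.sub_apply]
  have hgradS : ∀ j ∈ S, (Xᵀ *ᵥ (X *ᵥ (βo + w) - y)) j / n = -r ((βo + w) j) := fun j hj => by
    have h1 : (Xᵀ *ᵥ projPerp X S ε) j = 0 := by
      rw [← residual_eq_projPerp hy hS hgram]
      exact transpose_mulVec_residual X y hgram hj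
    have h2 : (Xᵀ *ᵥ (cols X S *ᵥ v)) j = (gram X S *ᵥ v) ⟨j, hj⟩ := by
      rw [gram_mulVec]
      rfl
    have h3 : (βo + w) j = v ⟨j, hj⟩ + βo j := by
      simp [w, hj, add_comm]
    rw [hgrad, h1, h2, hGv, h3, Pi.neg_apply, Pi.smul_apply, smul_eq_mul, sub_zero]
    field_simp
  have hcross : ∀ j, j ∉ S → |(Xᵀ *ᵥ (cols X S *ᵥ v)) j / n| ≤ θ₂ * l := by
    intro j hj
    -- If `λ* = 0`, the quotient defining `θ₂` carries no information, but the box is a point and `v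
    -- = 0`.
    rcases hl0.eq_or_lt with h | h
    · have hv0 : v = 0 := by
        have : C = 0 := by simp only [C, ← h, mul_zero]
        rw [this] at hv
        exact norm_le_zero_iff.1 hv
      simp [hv0, ← h]
    · have h1 := norm_le_theta2_mul hn hgram h hne (v := v) (by rw [← hθ₁]; exact hv)
      rw [← hθ₂] at h1
      have h2 := (norm_le_pi_norm _ ⟨j, Finset.mem_compl.2 hj⟩).trans h1
      rw [cols_transpose_mulVec] at h2
      have h3 : (Xᵀ *ᵥ (cols X S *ᵥ v)) j / n = -(Xᵀ *ᵥ (cols X S *ᵥ ((gram X S)⁻¹ *ᵥ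
          fun j : {j // j ∈ S} => r (v j + βo j)))) j := by
        conv_lhs => rw [hvinv]
        simp only [Matrix.mulVec_neg, Matrix.mulVec_smul, Pi.neg_apply, Pi.smul_apply,
          smul_eq_mul]
        field_simp
      rw [h3, abs_neg]
      exact h2
  have hnoise' : ∀ j, |(Xᵀ *ᵥ projPerp X S ε) j / n| ≤ (1 - θ₂) * l := fun j => by
    rw [div_le_iff₀ (sub_pos.2 hθ₂1), mul_comm] at hnoise
    exact (norm_le_pi_norm (fun j : Fin p => (Xᵀ *ᵥ projPerp X S ε) j / n) j).trans hnoise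
  refine ⟨βo + w, ⟨fun j => -((Xᵀ *ᵥ (X *ᵥ (βo + w) - y)) j / n), fun j => ?_, ?_⟩,
    fun j => ?_, ?_⟩
  · by_cases hj : j ∈ S
    · simp only
      rw [hgradS j hj, neg_neg]
      exact hr _
    · have h0 : (βo + w) j = 0 := by
        rw [Pi.add_apply, hwS j hj, hβo, oracle_of_notMem X y hj, add_zero]
      rw [h0]
      refine mem_pdot_zero hρ hD (le_trans (EReal.coe_le_coe_iff.2 ?_)
        (threshold_le_rightSlope hρ hD))
      rw [abs_neg, hgrad, sub_div, ← hl]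
      have h1 := abs_sub ((Xᵀ *ᵥ (cols X S *ᵥ v)) j / n) ((Xᵀ *ᵥ projPerp X S ε) j / n)
      linarith [hcross j hj, hnoise' j]
  · simp
  · rw [← hsign j]
    by_cases hj : j ∈ S
    · exact sign_add_of_abs_lt ((hwC j).trans_lt (hmin j hj))
    · rw [Pi.add_apply, hwS j hj, add_zero]
  · rw [add_sub_cancel_left]
    exact (pi_norm_le_iff_of_nonneg hC).2 hwC

end

end PenLS

/-! ### The theorem. -/

theorem theorem6 {n p : ℕ} (hn : 0 < n)
    (X : Matrix (Fin n) (Fin p) ℝ) (hX : ∀ j, ∑ i, X i j ^ 2 = n)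
    (β : Fin p → ℝ) (ε y : Fin n → ℝ) (hy : y = X.mulVec β + ε)
    (ρ : ℝ → ℝ) (lam : ℝ) (hlam : 0 < lam)
    (hρ : PenLS.IsPenalty ρ) (hdiff : PenLS.LRDifferentiable ρ)
    (S : Finset (Fin p)) (hS : S = PenLS.supp β)
    (hgram : IsUnit (PenLS.gram X S).det)
    (βo : Fin p → ℝ) (hβo : βo = PenLS.oracle X y S)
    (lamStar : ℝ) (hlamStar : lamStar = PenLS.threshold ρ) :
    -- part (i)
    (∀ D : EReal, PenLS.HasRightSlope ρ 0 D →
      ((‖fun j : {j // j ∈ Sᶜ} =>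
          (X.transpose.mulVec (PenLS.projPerp X S ε)) j / n‖ : ℝ) : EReal) ≤ D →
      (∀ d : Fin p → ℝ, (∀ j ∈ S, d j ∈ PenLS.pdot ρ (βo j)) →
        PenLS.IsApproxLocal X y ρ (∑ j ∈ S, d j ^ 2) βo) ∧
      (∀ (η m κ : ℝ) (d : Fin p → ℝ), 0 < η → η < 1 → PenLS.NullConsistent X ε ρ η →
        (PenLS.IsSparsityBound X ε ρ S η m ∨ PenLS.IsSparsityBoundBounded X ρ lam S η m) →
        0 ≤ κ → ENNReal.ofReal κ < PenLS.kappaMinus X (m + S.card) →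
        PenLS.IsApproxLocalWith X y ρ (∑ j ∈ S, d j ^ 2) βo d →
        ∑ j ∈ S, d j ^ 2 = 0 →
        (∀ j, PenLS.nonconvexity ρ κ (βo j) (d j) = 0) →
        PenLS.IsGlobalSolution X y ρ βo)) ∧
    -- part (ii)
    (∀ r : ℝ → ℝ, (∀ t, r t ∈ PenLS.pdot ρ t) →
      ∀ θ₁ θ₂ : ℝ, (PenLS.theta1Set X S lamStar r βo).Nonempty →
      θ₁ = PenLS.theta1 X S lamStar r βo → θ₂ = PenLS.theta2 X S lamStar r βo →
      UniformContinuousOn r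
        (⋃ j ∈ S, Set.Icc (βo j - θ₁ * lamStar) (βo j + θ₁ * lamStar)) →
      (∀ j, Real.sign (βo j) = Real.sign (β j)) →
      (∀ j ∈ S, θ₁ * lamStar < |βo j|) →
      θ₂ < 1 →
      ‖fun j : Fin p => (X.transpose.mulVec (PenLS.projPerp X S ε)) j / n‖ / (1 - θ₂)
        ≤ lamStar →
      (∃ b : Fin p → ℝ, PenLS.IsApproxLocal X y ρ 0 b ∧
        (∀ j, Real.sign (b j) = Real.sign (β j)) ∧ ‖b - βo‖ ≤ θ₁ * lamStar) ∧
      (∀ b d : Fin p → ℝ, PenLS.IsApproxLocalWith X y ρ 0 b d →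
        (∀ j, Real.sign (b j) = Real.sign (β j)) → ‖b - βo‖ ≤ θ₁ * lamStar →
        ∀ η m κ : ℝ, 0 < η → η < 1 → PenLS.NullConsistent X ε ρ η →
        (PenLS.IsSparsityBound X ε ρ S η m ∨ PenLS.IsSparsityBoundBounded X ρ lam S η m) →
        0 ≤ κ → ENNReal.ofReal κ < PenLS.kappaMinus X (m + S.card) →
        (∀ j, PenLS.nonconvexity ρ κ (b j) (d j) = 0) →
        PenLS.IsGlobalSolution X y ρ b)) := by
  have hβ : ∀ j, j ∉ S → β j = 0 := fun j hj => by
    rw [hS] at hj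
    simpa [PenLS.supp] using hj
  refine ⟨fun D hD hnoise => ⟨fun d hd => ?_, ?_⟩, ?_⟩
  · subst hβo
    exact PenLS.isApproxLocal_oracle hρ hD hy hS hgram hnoise hd
  · intro η m κ d h0 h1 hnull hm hκ hκm hloc hd0 hθ
    rw [hd0] at hloc
    refine PenLS.isGlobalSolution_of_local hn hρ hdiff hD hX hy hS hlam h0 h1 hnull hm hκ hκm
      hloc (fun j hj => ?_) hθ
    rw [hβo, PenLS.oracle_of_notMem X y hj]
  · intro r hr θ₁ θ₂ hne hθ₁ hθ₂ hunif hsign hmin hθ₂1 hnoise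
    refine ⟨PenLS.exists_isApproxLocal_near_oracle hn hρ hy hS hgram hβo hlamStar hr hne hθ₁ hθ₂
      hunif hsign hmin hθ₂1 hnoise, ?_⟩
    intro b d hloc hbsign _ η m κ h0 h1 hnull hm hκ hκm hθ
    -- An admissible value at `0` carries a right derivative there, possibly infinite.
    obtain ⟨a, D, -, hD, -⟩ := hr 0
    refine PenLS.isGlobalSolution_of_local hn hρ hdiff hD hX hy hS hlam h0 h1 hnull hm hκ hκm
      hloc (fun j hj => ?_) hθ
    -- Equality of signs makes `b` vanish wherever `β` does, so its support lies in `S`.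
    have h2 := hbsign j
    rw [hβ j hj, Real.sign_zero] at h2
    exact Real.sign_eq_zero_iff.1 h2
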